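/- Let $\pi:E\to M$ be a fibered manifold, i.e. a smooth surjective submersion, with $\dim M=n$ and $\dim E=m=n+k$. Indices $i,a$ run over $1,\dots,n$, indices $A$ over the remaining $k$ values, and $\alpha=(i,A)$. Let $LE$ be the bundle of linear frames of $E$, with projection $\lambda:LE\to E$, and let $\hat\theta=(\theta^\alpha)$ be its $\mathbb R^m$-valued soldering 1-form: $\theta^\alpha_u(X)=e^\alpha(\lambda_*X)$ for a frame $u=(e,e_\alpha)$ with dual frame $(e^\alpha)$. Let $L_\pi E\subset LE$ be the bundle of adapted frames $u=(e,e_i,e_A)$, those with every $e_A$ vertical ($\pi_*e_A=0$); the restrictions of $\theta^i,\theta^A$ to $L_\pi E$ are denoted by the same symbols. Let $J^1\pi$ be the first jet bundle, the manifold of all linear right inverses $T_{\pi(e)}M\to T_eE$ of $\pi_*(e)$, $e\in E$, and let $\rho:L_\pi E\to J^1\pi$ send $(e,e_i,e_A)$ to the linear map $\pi_*e_i\mapsto e_i$. Let $\mathcal L:J^1\pi\to\mathbb R$ be a smooth Lagrangian whose pull-up $L=\rho^*\mathcal L$ to $L_\pi E$ vanishes nowhere, and let $\tau$ be a positive function of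 $n$. Write $$E^{*i}_A(L)(u)=\frac{d}{dt}\Big|_{t=0}L(u\cdot\exp(tE^i_A))=\frac{d}{dt}\Big|_{t=0}L(e,e_1,\dots,e_i+t\,e_A,\dots,e_n,e_B)$$ for the derivative of $L$ along the fundamental vertical vector field of the standard basis element $E^i_A\in\mathfrak{gl}(m,\mathbb R)$. The $m$-symplectic Legendre transformation $\phi_L:L_\pi E\to LE$ is $$\phi_L(e,e_i,e_A)=\Big(e,\ \frac{1}{\tau(n)L(u)}\,e_i,\ e_A-\frac{1}{\tau(n)L(u)}\sum_{a=1}^nE^{*a}_A(L)(u)\,e_a\Big),\qquad u=(e,e_i,e_A),$$ and the $\mathbb R^m$-valued Cartan–Hamilton–Poincaré 1-form $\hat\theta_L=(\theta^i_L,\theta^A_L)$ on $L_\pi E$ is $$\theta^i_L=\tau(n)L\,\theta^i+\sum_AE^{*i}_A(L)\,\theta^A,\qquad \theta^A_L=\theta^A .$$ Then $\phi_L$ is a smooth map from $L_\pi E$ to $LE$, and $$\phi_L^*\hat\theta=\hat\theta_L .$$ -/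

import Mathlib

open Bundle Set
open scoped Manifold ContDiff Topology

noncomputable section

/-- A fibered manifold `π : E → M` (surjective submersion) of an `(n + k)`-dimensional smooth manifold
`E` over an `n`-dimensional smooth manifold `M`. -/
structure FiberedManifold (n k : ℕ) (E M : Type*)
    [TopologicalSpace M] [ChartedSpace (EuclideanSpace ℝ (Fin n)) M] [IsManifold (𝓡 n) ∞ M]
    [TopologicalSpace E] [ChartedSpace (EuclideanSpace ℝ (Fin (n + k))) E]
    [IsManifold (𝓡 (n + k)) ∞ E] where
  proj : C^∞⟮𝓡 (n + k), E; 𝓡 n, M⟯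
  surjective : Function.Surjective proj
  submersion : ∀ e : E, Function.Surjective (mfderiv (𝓡 (n + k)) (𝓡 n) proj e)

instance {m : ℕ} {N : Type*} [TopologicalSpace N] [ChartedSpace (EuclideanSpace ℝ (Fin m)) N]
    (x : N) : T2Space (TangentSpace (𝓡 m) x) :=
  inferInstanceAs (T2Space (EuclideanSpace ℝ (Fin m)))
instance {m : ℕ} {N : Type*} [TopologicalSpace N] [ChartedSpace (EuclideanSpace ℝ (Fin m)) N]
    (x : N) : FiniteDimensional ℝ (TangentSpace (𝓡 m) x) :=
  inferInstanceAs (FiniteDimensional ℝ (EuclideanSpace ℝ (Fin m)))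

lemma finrank_tangentSpace {m : ℕ} {N : Type*} [TopologicalSpace N]
    [ChartedSpace (EuclideanSpace ℝ (Fin m)) N] (x : N) :
    Module.finrank ℝ (TangentSpace (𝓡 m) x) = m :=
  finrank_euclideanSpace_fin (𝕜 := ℝ)

lemma isInvertible_of_injective {F G : Type*} [AddCommGroup F] [Module ℝ F] [TopologicalSpace F]
    [IsTopologicalAddGroup F] [ContinuousSMul ℝ F] [T2Space F] [FiniteDimensional ℝ F]
    [AddCommGroup G] [Module ℝ G] [TopologicalSpace G]
    [IsTopologicalAddGroup G] [ContinuousSMul ℝ G] [T2Space G] [FiniteDimensional ℝ G]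
    {f : F →L[ℝ] G} (hf : Function.Injective f)
    (h : Module.finrank ℝ F = Module.finrank ℝ G) : f.IsInvertible :=
  ⟨(LinearEquiv.ofInjectiveOfFinrankEq f.toLinearMap hf h).toContinuousLinearEquiv, by
    ext; rfl⟩

namespace FiberedManifold

variable {n k : ℕ} {E M : Type*}
  [TopologicalSpace M] [ChartedSpace (EuclideanSpace ℝ (Fin n)) M] [IsManifold (𝓡 n) ∞ M]
  [TopologicalSpace E] [ChartedSpace (EuclideanSpace ℝ (Fin (n + k))) E]
  [IsManifold (𝓡 (n + k)) ∞ E]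

variable (P : FiberedManifold n k E M)

/-- The fibre at `e` of the pull-back bundle `π^* TM`, i.e. the tangent space `T_{π(e)} M`. -/
def PullTM (e : E) : Type := TangentSpace (𝓡 n) (P.proj e)

instance (e : E) : AddCommGroup (P.PullTM e) :=
  inferInstanceAs (AddCommGroup (TangentSpace (𝓡 n) (P.proj e)))
instance (e : E) : Module ℝ (P.PullTM e) :=
  inferInstanceAs (Module ℝ (TangentSpace (𝓡 n) (P.proj e)))
instance (e : E) : TopologicalSpace (P.PullTM e) :=
  inferInstanceAs (TopologicalSpace (TangentSpace (𝓡 n) (P.proj e)))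
instance (e : E) : IsTopologicalAddGroup (P.PullTM e) :=
  inferInstanceAs (IsTopologicalAddGroup (TangentSpace (𝓡 n) (P.proj e)))
instance (e : E) : ContinuousSMul ℝ (P.PullTM e) :=
  inferInstanceAs (ContinuousSMul ℝ (TangentSpace (𝓡 n) (P.proj e)))
instance : TopologicalSpace (TotalSpace (EuclideanSpace ℝ (Fin n)) P.PullTM) :=
  inferInstanceAs (TopologicalSpace (TotalSpace (EuclideanSpace ℝ (Fin n))
    ((P.proj : E → M) *ᵖ (TangentSpace (𝓡 n) : M → Type _))))
instance : FiberBundle (EuclideanSpace ℝ (Fin n)) P.PullTM :=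
  inferInstanceAs (FiberBundle (EuclideanSpace ℝ (Fin n))
    ((P.proj : E → M) *ᵖ (TangentSpace (𝓡 n) : M → Type _)))
instance : VectorBundle ℝ (EuclideanSpace ℝ (Fin n)) P.PullTM :=
  inferInstanceAs (VectorBundle ℝ (EuclideanSpace ℝ (Fin n))
    ((P.proj : E → M) *ᵖ (TangentSpace (𝓡 n) : M → Type _)))
instance : ContMDiffVectorBundle ∞ (EuclideanSpace ℝ (Fin n)) P.PullTM (𝓡 (n + k)) :=
  inferInstanceAs (ContMDiffVectorBundle ∞ (EuclideanSpace ℝ (Fin n))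
    ((P.proj : E → M) *ᵖ (TangentSpace (𝓡 n) : M → Type _)) (𝓡 (n + k)))


/-- The differential `π_*(e) : T_e E → T_{π(e)} M`. -/
def dproj (P : FiberedManifold n k E M) (e : E) :
    TangentSpace (𝓡 (n + k)) e →L[ℝ] P.PullTM e :=
  mfderiv (𝓡 (n + k)) (𝓡 n) P.proj e

/-- The space of vertical vectors `V_e π = ker π_*(e) ⊆ T_e E`. -/
def vertical (P : FiberedManifold n k E M) (e : E) :
    Submodule ℝ (TangentSpace (𝓡 (n + k)) e) :=
  LinearMap.ker (P.dproj e).toLinearMap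

/-- The fibres of the vertical bundle `Vπ ⊆ TE`; it is made into a smooth vector bundle below. -/
def VertBundle (P : FiberedManifold n k E M) (e : E) : Type := P.vertical e

instance (e : E) : AddCommGroup (P.VertBundle e) := inferInstanceAs (AddCommGroup (P.vertical e))
instance (e : E) : Module ℝ (P.VertBundle e) := inferInstanceAs (Module ℝ (P.vertical e))
instance (e : E) : TopologicalSpace (P.VertBundle e) :=
  inferInstanceAs (TopologicalSpace (P.vertical e))
instance (e : E) : IsTopologicalAddGroup (P.VertBundle e) :=
  inferInstanceAs (IsTopologicalAddGroup (P.vertical e))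
instance (e : E) : ContinuousSMul ℝ (P.VertBundle e) :=
  inferInstanceAs (ContinuousSMul ℝ (P.vertical e))

/-- The inclusion `V_e π → T_e E`. -/
def vertIncl (e : E) : P.VertBundle e →L[ℝ] TangentSpace (𝓡 (n + k)) e := (P.vertical e).subtypeL

/-- Domain on which the tangent bundles of `E` and `M` are trivialized by the charts at `e₀` and
`π(e₀)`. -/
def chartDom (e₀ : E) : Set E :=
  (trivializationAt (EuclideanSpace ℝ (Fin (n + k))) (TangentSpace (𝓡 (n + k)) : E → Type _) e₀).baseSet ∩
    (trivializationAt (EuclideanSpace ℝ (Fin n)) P.PullTM e₀).baseSet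

/-- The differential `π_*(e)` read in the charts at `e₀` and `π(e₀)`. -/
def coordDproj (e₀ e : E) : EuclideanSpace ℝ (Fin (n + k)) →L[ℝ] EuclideanSpace ℝ (Fin n) :=
  ContinuousLinearMap.inCoordinates (EuclideanSpace ℝ (Fin (n + k))) (TangentSpace (𝓡 (n + k)) : E → Type _)
    (EuclideanSpace ℝ (Fin n)) P.PullTM e₀ e e₀ e (P.dproj e)

lemma mem_chartDom (e₀ : E) : e₀ ∈ P.chartDom e₀ :=
  ⟨FiberBundle.mem_baseSet_trivializationAt' e₀, FiberBundle.mem_baseSet_trivializationAt' e₀⟩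

lemma isOpen_chartDom (e₀ : E) : IsOpen (P.chartDom e₀) :=
  (Trivialization.open_baseSet _).inter (Trivialization.open_baseSet _)

lemma contMDiffOn_coordDproj (e₀ : E) :
    ContMDiffOn (𝓡 (n + k)) 𝓘(ℝ, EuclideanSpace ℝ (Fin (n + k)) →L[ℝ] EuclideanSpace ℝ (Fin n)) ∞ (P.coordDproj e₀) (P.chartDom e₀) := by
  have h : ContMDiff (𝓡 (n + k)) ((𝓡 (n + k)).prod 𝓘(ℝ, EuclideanSpace ℝ (Fin (n + k)) →L[ℝ] EuclideanSpace ℝ (Fin n))) ∞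
    (fun e => TotalSpace.mk' (EuclideanSpace ℝ (Fin (n + k)) →L[ℝ] EuclideanSpace ℝ (Fin n))
      (E := fun e : E => TangentSpace (𝓡 (n + k)) e →L[ℝ] P.PullTM e) e (P.dproj e)) := by
    intro e
    rw [contMDiffAt_hom_bundle]
    refine ⟨contMDiffAt_id, ?_⟩
    exact (P.proj.contMDiff e).mfderiv_const (by simp)
  have h2 := ((trivializationAt (EuclideanSpace ℝ (Fin (n + k)) →L[ℝ] EuclideanSpace ℝ (Fin n))
    (fun e : E => TangentSpace (𝓡 (n + k)) e →L[ℝ] P.PullTM e) e₀).contMDiffOn_section_baseSet_iff (IB := 𝓡 (n + k)) (n := ∞)).1 h.contMDiffOn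
  exact h2

lemma exists_compl (A : EuclideanSpace ℝ (Fin (n + k)) →L[ℝ] EuclideanSpace ℝ (Fin n)) (hA : Function.Surjective A) :
    ∃ q : EuclideanSpace ℝ (Fin (n + k)) →L[ℝ] EuclideanSpace ℝ (Fin k), (A.prod q).IsInvertible := by
  have hr := A.toLinearMap.finrank_range_add_finrank_ker
  rw [LinearMap.range_eq_top.2 hA, finrank_top] at hr
  simp only [finrank_euclideanSpace, Fintype.card_fin] at hr
  obtain ⟨C, hC⟩ := (LinearMap.ker A.toLinearMap).exists_isCompl
  have hk : Module.finrank ℝ (LinearMap.ker A.toLinearMap) = Module.finrank ℝ (EuclideanSpace ℝ (Fin k)) := by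
    simp; omega
  let ψ := LinearEquiv.ofFinrankEq _ _ hk
  let q : EuclideanSpace ℝ (Fin (n + k)) →ₗ[ℝ] EuclideanSpace ℝ (Fin k) :=
    ψ.toLinearMap ∘ₗ Submodule.projectionOnto _ C hC
  refine ⟨q.toContinuousLinearMap, ?_⟩
  have hinj : Function.Injective (A.prod q.toContinuousLinearMap) := by
    rw [injective_iff_map_eq_zero]
    intro v hv
    have h1 : A v = 0 := congrArg Prod.fst hv
    have h2 : q v = 0 := congrArg Prod.snd hv
    have h3 : Submodule.projectionOnto _ C hC v = 0 := by
      simpa [q] using h2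
    have h4 := Submodule.projectionOnto_apply_left hC ⟨v, h1⟩
    rw [h3] at h4
    exact (congrArg Subtype.val h4).symm
  exact ⟨(LinearEquiv.ofInjectiveOfFinrankEq (A.prod q.toContinuousLinearMap).toLinearMap hinj (by simp)).toContinuousLinearEquiv, by ext <;> rfl⟩

lemma surjective_coordDproj (e₀ : E) : Function.Surjective (P.coordDproj e₀ e₀) := by
  rw [coordDproj, ContinuousLinearMap.inCoordinates_eq (P.mem_chartDom e₀).1 (P.mem_chartDom e₀).2]
  rw [ContinuousLinearMap.coe_comp, ContinuousLinearMap.coe_comp]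
  exact (ContinuousLinearEquiv.surjective _).comp
    ((show Function.Surjective (P.dproj e₀) from P.submersion e₀).comp
      (ContinuousLinearEquiv.surjective _))

/-- A linear map completing `π_*(e₀)`, read in charts, to an isomorphism `ℝ^(n+k) ≅ ℝ^n × ℝ^k`. -/
def compl (e₀ : E) : EuclideanSpace ℝ (Fin (n + k)) →L[ℝ] EuclideanSpace ℝ (Fin k) :=
  (exists_compl _ (P.surjective_coordDproj e₀)).choose

/-- `(π_*(e), compl)` read in the charts at `e₀`; near `e₀` it is an isomorphism that carries vertical
vectors to `{0} × ℝ^k`. -/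
def splitting (e₀ e : E) :
    EuclideanSpace ℝ (Fin (n + k)) →L[ℝ] EuclideanSpace ℝ (Fin n) × EuclideanSpace ℝ (Fin k) :=
  (P.coordDproj e₀ e).prod (P.compl e₀)

/-- Domain of the local trivialization of `Vπ` around `e₀`. -/
def vertDom (e₀ : E) : Set E := P.chartDom e₀ ∩ {e | (P.splitting e₀ e).IsInvertible}

lemma mem_vertDom (e₀ : E) : e₀ ∈ P.vertDom e₀ :=
  ⟨P.mem_chartDom e₀, (exists_compl _ (P.surjective_coordDproj e₀)).choose_spec⟩

lemma contMDiffOn_splitting (e₀ : E) :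
    ContMDiffOn (𝓡 (n + k)) 𝓘(ℝ, EuclideanSpace ℝ (Fin (n + k)) →L[ℝ]
      EuclideanSpace ℝ (Fin n) × EuclideanSpace ℝ (Fin k)) ∞ (P.splitting e₀) (P.chartDom e₀) := by
  have h := P.contMDiffOn_coordDproj e₀
  have h2 : P.splitting e₀ = fun e =>
      (ContinuousLinearMap.inl ℝ (EuclideanSpace ℝ (Fin n)) (EuclideanSpace ℝ (Fin k))).comp (P.coordDproj e₀ e) +
      (ContinuousLinearMap.inr ℝ (EuclideanSpace ℝ (Fin n)) (EuclideanSpace ℝ (Fin k))).comp (P.compl e₀) := by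
    funext e
    refine ContinuousLinearMap.ext fun v => ?_
    refine Prod.ext ?_ ?_ <;> simp [splitting]
  rw [h2]
  exact (contMDiffOn_const.clm_comp h).add contMDiffOn_const

lemma isOpen_vertDom (e₀ : E) : IsOpen (P.vertDom e₀) :=
  (P.contMDiffOn_splitting e₀).continuousOn.isOpen_inter_preimage (P.isOpen_chartDom e₀)
    ContinuousLinearEquiv.isOpen

lemma contMDiffOn_inverse_splitting (e₀ : E) :
    ContMDiffOn (𝓡 (n + k)) 𝓘(ℝ, EuclideanSpace ℝ (Fin n) × EuclideanSpace ℝ (Fin k) →L[ℝ]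
      EuclideanSpace ℝ (Fin (n + k))) ∞ (fun e => (P.splitting e₀ e).inverse) (P.vertDom e₀) := by
  intro e he
  obtain ⟨φ, hφ⟩ := he.2
  have h1 : ContDiffAt ℝ ∞ ContinuousLinearMap.inverse (P.splitting e₀ e) := by
    rw [← hφ]; exact contDiffAt_map_inverse φ
  exact h1.contMDiffAt.comp_contMDiffWithinAt e ((P.contMDiffOn_splitting e₀ e he.1).mono inter_subset_left)

lemma coordDproj_continuousLinearMapAt {e₀ e : E} (he : e ∈ P.chartDom e₀)
    (v : TangentSpace (𝓡 (n + k)) e) :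
    P.coordDproj e₀ e ((trivializationAt (EuclideanSpace ℝ (Fin (n + k)))
      (TangentSpace (𝓡 (n + k)) : E → Type _) e₀).continuousLinearMapAt ℝ e v) =
    (trivializationAt (EuclideanSpace ℝ (Fin n)) P.PullTM e₀).continuousLinearMapAt ℝ e (P.dproj e v) := by
  simp only [coordDproj, ContinuousLinearMap.inCoordinates, ContinuousLinearMap.comp_apply]
  rw [Trivialization.symmL_continuousLinearMapAt _ he.1]

lemma dproj_symmL_eq_zero {e₀ e : E} (he : e ∈ P.chartDom e₀) (w : EuclideanSpace ℝ (Fin (n + k))) :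
    P.dproj e ((trivializationAt (EuclideanSpace ℝ (Fin (n + k)))
      (TangentSpace (𝓡 (n + k)) : E → Type _) e₀).symmL ℝ e w) = 0 ↔ P.coordDproj e₀ e w = 0 := by
  have h := P.coordDproj_continuousLinearMapAt he ((trivializationAt (EuclideanSpace ℝ (Fin (n + k)))
      (TangentSpace (𝓡 (n + k)) : E → Type _) e₀).symmL ℝ e w)
  rw [Trivialization.continuousLinearMapAt_symmL _ he.1] at h
  rw [h]
  constructor
  · intro h0; rw [h0]; exact map_zero _
  · intro h0
    have := congrArg ((trivializationAt (EuclideanSpace ℝ (Fin n)) P.PullTM e₀).symmL ℝ e) h0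
    rw [Trivialization.symmL_continuousLinearMapAt _ he.2, map_zero] at this
    exact this

lemma symmL_mem_vertical {e₀ e : E} (h : e ∈ P.vertDom e₀) (w : EuclideanSpace ℝ (Fin k)) :
    (trivializationAt (EuclideanSpace ℝ (Fin (n + k))) (TangentSpace (𝓡 (n + k)) : E → Type _)
      e₀).symmL ℝ e ((P.splitting e₀ e).inverse (0, w)) ∈ P.vertical e :=
  (P.dproj_symmL_eq_zero h.1 _).2 (congrArg Prod.fst (h.2.self_apply_inverse (0, w)))

open Classical in
def vertSymm (e₀ e : E) (w : EuclideanSpace ℝ (Fin k)) : P.VertBundle e :=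
  if h : e ∈ P.vertDom e₀ then (⟨_, P.symmL_mem_vertical h w⟩ : P.vertical e) else 0

/-- Local trivialization of `Vπ` around `e₀`, on fibres. -/
def vertCoord (e₀ e : E) : P.VertBundle e →L[ℝ] EuclideanSpace ℝ (Fin k) :=
  ((P.compl e₀).comp ((trivializationAt (EuclideanSpace ℝ (Fin (n + k)))
      (TangentSpace (𝓡 (n + k)) : E → Type _) e₀).continuousLinearMapAt ℝ e)).comp (P.vertIncl e)

lemma vertIncl_vertSymm {e₀ e : E} (h : e ∈ P.vertDom e₀) (w : EuclideanSpace ℝ (Fin k)) :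
    P.vertIncl e (P.vertSymm e₀ e w) =
    (trivializationAt (EuclideanSpace ℝ (Fin (n + k))) (TangentSpace (𝓡 (n + k)) : E → Type _) e₀).symmL ℝ e
      ((P.splitting e₀ e).inverse (0, w)) := by
  have h1 : P.vertSymm e₀ e w = (⟨_, P.symmL_mem_vertical h w⟩ : P.vertical e) := dif_pos h
  rw [h1]
  rfl

lemma vertCoord_vertSymm {e₀ e : E} (h : e ∈ P.vertDom e₀) (w : EuclideanSpace ℝ (Fin k)) :
    P.vertCoord e₀ e (P.vertSymm e₀ e w) = w := by
  simp only [vertCoord, ContinuousLinearMap.comp_apply]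
  rw [P.vertIncl_vertSymm h, Trivialization.continuousLinearMapAt_symmL _ h.1.1]
  exact congrArg Prod.snd (h.2.self_apply_inverse (0, w))

lemma vertCoord_injective {e₀ e : E} (h : e ∈ P.vertDom e₀) :
    Function.Injective (P.vertCoord e₀ e) := by
  rw [injective_iff_map_eq_zero]
  intro v hv
  have hv0 : P.dproj e (P.vertIncl e v) = 0 := v.2
  have h1 := P.coordDproj_continuousLinearMapAt h.1 (P.vertIncl e v)
  rw [hv0, map_zero] at h1
  have h2 : P.splitting e₀ e ((trivializationAt (EuclideanSpace ℝ (Fin (n + k)))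
      (TangentSpace (𝓡 (n + k)) : E → Type _) e₀).continuousLinearMapAt ℝ e (P.vertIncl e v)) = 0 :=
    Prod.ext h1 hv
  have h3 := h.2.injective (h2.trans (map_zero _).symm)
  have h4 := congrArg ((trivializationAt (EuclideanSpace ℝ (Fin (n + k)))
      (TangentSpace (𝓡 (n + k)) : E → Type _) e₀).symmL ℝ e) h3
  rw [Trivialization.symmL_continuousLinearMapAt _ h.1.1, map_zero] at h4
  exact Subtype.ext h4

/-- The local trivialization of `Vπ` around `e₀`. -/
def vertPretriv (e₀ : E) :
    Pretrivialization (EuclideanSpace ℝ (Fin k)) (π (EuclideanSpace ℝ (Fin k)) P.VertBundle) where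
  toFun p := (p.1, P.vertCoord e₀ p.1 p.2)
  invFun p := ⟨p.1, P.vertSymm e₀ p.1 p.2⟩
  source := TotalSpace.proj ⁻¹' P.vertDom e₀
  target := P.vertDom e₀ ×ˢ univ
  map_source' _ h := ⟨h, mem_univ _⟩
  map_target' _ h := h.1
  left_inv' := fun ⟨e, v⟩ h => by
    refine congrArg (TotalSpace.mk e) (P.vertCoord_injective h ?_)
    exact P.vertCoord_vertSymm h _
  right_inv' := fun ⟨e, w⟩ h => by
    refine Prod.ext rfl ?_
    exact P.vertCoord_vertSymm h.1 w
  open_target := (P.isOpen_vertDom e₀).prod isOpen_univ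
  baseSet := P.vertDom e₀
  open_baseSet := P.isOpen_vertDom e₀
  source_eq := rfl
  target_eq := rfl
  proj_toFun _ _ := rfl

/-- Transition functions of `Vπ`. -/
def vertCoordChange (e₀ e₁ e : E) : EuclideanSpace ℝ (Fin k) →L[ℝ] EuclideanSpace ℝ (Fin k) :=
  (P.compl e₁).comp ((((trivializationAt (EuclideanSpace ℝ (Fin (n + k)))
    (TangentSpace (𝓡 (n + k)) : E → Type _) e₀).coordChangeL ℝ
    (trivializationAt (EuclideanSpace ℝ (Fin (n + k)))
    (TangentSpace (𝓡 (n + k)) : E → Type _) e₁) e : EuclideanSpace ℝ (Fin (n + k)) →L[ℝ] EuclideanSpace ℝ (Fin (n + k)))).comp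
    ((P.splitting e₀ e).inverse.comp
      (ContinuousLinearMap.inr ℝ (EuclideanSpace ℝ (Fin n)) (EuclideanSpace ℝ (Fin k)))))

lemma contMDiffOn_vertCoordChange (e₀ e₁ : E) :
    ContMDiffOn (𝓡 (n + k)) 𝓘(ℝ, EuclideanSpace ℝ (Fin k) →L[ℝ] EuclideanSpace ℝ (Fin k)) ∞
      (P.vertCoordChange e₀ e₁) (P.vertDom e₀ ∩ P.vertDom e₁) := by
  refine ContMDiffOn.clm_comp contMDiffOn_const (ContMDiffOn.clm_comp ?_ (ContMDiffOn.clm_comp ?_ contMDiffOn_const))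
  · exact (contMDiffOn_coordChangeL _ _).mono (inter_subset_inter (fun e h => h.1.1) (fun e h => h.1.1))
  · exact (P.contMDiffOn_inverse_splitting e₀).mono inter_subset_left

lemma vertCoordChange_apply {e₀ e₁ e : E} (h : e ∈ P.vertDom e₀ ∩ P.vertDom e₁)
    (w : EuclideanSpace ℝ (Fin k)) :
    P.vertCoordChange e₀ e₁ e w = (P.vertPretriv e₁ ⟨e, (P.vertPretriv e₀).symm e w⟩).2 := by
  rw [Pretrivialization.symm_apply _ h.1]
  change _ = P.vertCoord e₁ e (P.vertSymm e₀ e w)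
  simp only [vertCoord, ContinuousLinearMap.comp_apply, vertCoordChange]
  rw [P.vertIncl_vertSymm h.1]
  simp only [ContinuousLinearEquiv.coe_coe]
  rw [Trivialization.coordChangeL_apply _ _ ⟨h.1.1.1, h.2.1.1⟩]
  rw [Trivialization.continuousLinearMapAt_apply, Trivialization.coe_linearMapAt_of_mem _ h.2.1.1,
    Trivialization.symmL_apply _ h.1.1.1]
  rfl

/-- `Vπ` as a vector bundle of rank `k`. -/
def vertPrebundle : VectorPrebundle ℝ (EuclideanSpace ℝ (Fin k)) P.VertBundle where
  pretrivializationAtlas := range P.vertPretriv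
  pretrivialization_linear' := by
    rintro _ ⟨e₀, rfl⟩
    exact ⟨fun e _ => ⟨map_add (P.vertCoord e₀ e), map_smul (P.vertCoord e₀ e)⟩⟩
  pretrivializationAt := P.vertPretriv
  mem_base_pretrivializationAt := P.mem_vertDom
  pretrivialization_mem_atlas e := mem_range_self e
  exists_coordChange := by
    rintro _ ⟨e₀, rfl⟩ _ ⟨e₁, rfl⟩
    exact ⟨P.vertCoordChange e₀ e₁, (P.contMDiffOn_vertCoordChange e₀ e₁).continuousOn,
      fun _ h w => P.vertCoordChange_apply h w⟩
  totalSpaceMk_isInducing e := by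
    refine Topology.isInducing_const_prod.2 ?_
    have : T2Space (TangentSpace (𝓡 (n + k)) e) :=
      inferInstanceAs (T2Space (EuclideanSpace ℝ (Fin (n + k))))
    have : FiniteDimensional ℝ (TangentSpace (𝓡 (n + k)) e) :=
      inferInstanceAs (FiniteDimensional ℝ (EuclideanSpace ℝ (Fin (n + k))))
    have : T2Space (P.VertBundle e) := inferInstanceAs (T2Space (P.vertical e))
    have : FiniteDimensional ℝ (P.VertBundle e) := inferInstanceAs (FiniteDimensional ℝ (P.vertical e))
    exact (LinearMap.isClosedEmbedding_of_injective (f := (P.vertCoord e e).toLinearMap)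
      (LinearMap.ker_eq_bot.2 (P.vertCoord_injective (P.mem_vertDom e)))).isInducing

instance : TopologicalSpace (TotalSpace (EuclideanSpace ℝ (Fin k)) P.VertBundle) :=
  P.vertPrebundle.totalSpaceTopology
instance : FiberBundle (EuclideanSpace ℝ (Fin k)) P.VertBundle := P.vertPrebundle.toFiberBundle
instance : VectorBundle ℝ (EuclideanSpace ℝ (Fin k)) P.VertBundle := P.vertPrebundle.toVectorBundle
instance : P.vertPrebundle.IsContMDiff (𝓡 (n + k)) ∞ where
  exists_contMDiffCoordChange := by
    rintro _ ⟨e₀, rfl⟩ _ ⟨e₁, rfl⟩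
    exact ⟨P.vertCoordChange e₀ e₁, P.contMDiffOn_vertCoordChange e₀ e₁,
      fun _ h w => P.vertCoordChange_apply h w⟩
instance : ContMDiffVectorBundle ∞ (EuclideanSpace ℝ (Fin k)) P.VertBundle (𝓡 (n + k)) :=
  P.vertPrebundle.contMDiffVectorBundle (𝓡 (n + k))


instance (e : E) : T2Space (P.PullTM e) := inferInstanceAs (T2Space (TangentSpace (𝓡 n) (P.proj e)))
instance (e : E) : FiniteDimensional ℝ (P.PullTM e) :=
  inferInstanceAs (FiniteDimensional ℝ (TangentSpace (𝓡 n) (P.proj e)))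
instance (e : E) : T2Space (P.VertBundle e) := inferInstanceAs (T2Space (P.vertical e))
instance (e : E) : FiniteDimensional ℝ (P.VertBundle e) :=
  inferInstanceAs (FiniteDimensional ℝ (P.vertical e))

lemma finrank_pullTM (e : E) : Module.finrank ℝ (P.PullTM e) = n := finrank_tangentSpace (P.proj e)

lemma finrank_vertBundle (e : E) : Module.finrank ℝ (P.VertBundle e) = k := by
  have h := (P.dproj e).toLinearMap.finrank_range_add_finrank_ker
  rw [LinearMap.range_eq_top.2 (show Function.Surjective (P.dproj e) from P.submersion e),
    finrank_top, P.finrank_pullTM, finrank_tangentSpace] at h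
  exact Nat.add_left_cancel h

variable (n k E) in
/-- The manifold `Hom(ℝ^(n+k), TE)`, where `ℝ^(n+k)` has the coordinates `(z^i, z^A)`. -/
abbrev FrameTotal : Type _ :=
  TotalSpace ((Fin n ⊕ Fin k → ℝ) →L[ℝ] EuclideanSpace ℝ (Fin (n + k)))
    (fun e : E => Trivial E (Fin n ⊕ Fin k → ℝ) e →L[ℝ] TangentSpace (𝓡 (n + k)) e)

variable (n k) in
/-- The model of the manifolds `Hom(ℝ^(n+k), TE)` and `LE`. -/
abbrev linearFrameModel :=
  (𝓡 (n + k)).prod 𝓘(ℝ, (Fin n ⊕ Fin k → ℝ) →L[ℝ] EuclideanSpace ℝ (Fin (n + k)))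

variable (n k E) in
lemma isOpen_frames : IsOpen {u : FrameTotal n k E | u.2.IsInvertible} := by
  rw [isOpen_iff_forall_mem_open]
  intro u₀ hu₀
  let t := trivializationAt ((Fin n ⊕ Fin k → ℝ) →L[ℝ] EuclideanSpace ℝ (Fin (n + k)))
    (fun e : E => Trivial E (Fin n ⊕ Fin k → ℝ) e →L[ℝ] TangentSpace (𝓡 (n + k)) e) u₀.1
  have key : ∀ u ∈ t.source, ((t u).2.IsInvertible ↔ u.2.IsInvertible) := by
    intro u hu
    have h1 : (t u).2 = _ := congrArg Prod.snd (hom_trivializationAt_apply (RingHom.id ℝ) u₀.1 u)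
    rw [h1, ContinuousLinearMap.inCoordinates_eq hu.1 hu.2]
    rw [ContinuousLinearMap.isInvertible_equiv_comp, ContinuousLinearMap.isInvertible_comp_equiv]
  refine ⟨t.source ∩ (fun u => (t u).2) ⁻¹' {f | f.IsInvertible}, ?_, ?_, ?_, ?_⟩
  · rintro u ⟨hu, hu'⟩
    exact (key u hu).1 hu'
  · exact (continuous_snd.comp_continuousOn t.continuousOn).isOpen_inter_preimage t.open_source
      ContinuousLinearEquiv.isOpen
  · exact FiberBundle.mem_trivializationAt_proj_source
  · exact (key u₀ FiberBundle.mem_trivializationAt_proj_source).2 hu₀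

/-- The manifold `Hom(ℝ^n, TE) ⊕ Hom(ℝ^k, Vπ)`. -/
abbrev AdaptedTotal : Type _ :=
  TotalSpace (((Fin n → ℝ) →L[ℝ] EuclideanSpace ℝ (Fin (n + k))) ×
      ((Fin k → ℝ) →L[ℝ] EuclideanSpace ℝ (Fin k)))
    ((fun e : E => Trivial E (Fin n → ℝ) e →L[ℝ] TangentSpace (𝓡 (n + k)) e) ×ᵇ
      (fun e : E => Trivial E (Fin k → ℝ) e →L[ℝ] P.VertBundle e))

variable (n k) in
/-- The model of the manifolds `Hom(ℝ^n, TE) ⊕ Hom(ℝ^k, Vπ)` and `L_π E`. -/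
abbrev adaptedModel :=
  (𝓡 (n + k)).prod 𝓘(ℝ, ((Fin n → ℝ) →L[ℝ] EuclideanSpace ℝ (Fin (n + k))) ×
      ((Fin k → ℝ) →L[ℝ] EuclideanSpace ℝ (Fin k)))

variable {P} in
/-- The component `ℝ^n → T_e E`. -/
def AdaptedTotal.hor (u : P.AdaptedTotal) : (Fin n → ℝ) →L[ℝ] TangentSpace (𝓡 (n + k)) u.1 := u.2.1
variable {P} in
/-- The component `ℝ^k → V_e π`. -/
def AdaptedTotal.vert (u : P.AdaptedTotal) : (Fin k → ℝ) →L[ℝ] P.VertBundle u.1 := u.2.2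

variable {P} in
/-- The map `ℝ^(n+k) → T_e E` with the two components of `u`. -/
def AdaptedTotal.frame (u : P.AdaptedTotal) :
    (Fin n ⊕ Fin k → ℝ) →L[ℝ] TangentSpace (𝓡 (n + k)) u.1 :=
  u.hor.comp (ContinuousLinearMap.pi fun i => ContinuousLinearMap.proj (Sum.inl i)) +
  ((P.vertIncl u.1).comp u.vert).comp (ContinuousLinearMap.pi fun i => ContinuousLinearMap.proj (Sum.inr i))

lemma AdaptedTotal.frame_apply {P : FiberedManifold n k E M} (u : P.AdaptedTotal)
    (z : Fin n ⊕ Fin k → ℝ) :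
    u.frame z = u.hor (fun i => z (Sum.inl i)) +
      P.vertIncl u.1 (u.vert fun A => z (Sum.inr A)) := rfl

lemma AdaptedTotal.frame_single_inl {P : FiberedManifold n k E M} (u : P.AdaptedTotal) (i : Fin n) :
    u.frame (Pi.single (Sum.inl i) 1) = u.hor (Pi.single i 1) := by
  rw [AdaptedTotal.frame_apply]
  have h1 : (fun j : Fin n =>
      (Pi.single (Sum.inl i) 1 : Fin n ⊕ Fin k → ℝ) (Sum.inl j)) = Pi.single i 1 := by
    funext j; simp [Pi.single_apply]
  have h2 : (fun A : Fin k =>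
      (Pi.single (Sum.inl i) 1 : Fin n ⊕ Fin k → ℝ) (Sum.inr A)) = 0 := by
    funext A; simp
  have h0 : u.vert 0 = 0 := map_zero _
  rw [h1, h2, h0, map_zero, add_zero]

lemma AdaptedTotal.frame_single_inr {P : FiberedManifold n k E M} (u : P.AdaptedTotal) (A : Fin k) :
    u.frame (Pi.single (Sum.inr A) 1) = P.vertIncl u.1 (u.vert (Pi.single A 1)) := by
  rw [AdaptedTotal.frame_apply]
  have h1 : (fun j : Fin n =>
      (Pi.single (Sum.inr A) 1 : Fin n ⊕ Fin k → ℝ) (Sum.inl j)) = 0 := by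
    funext j; simp
  have h2 : (fun B : Fin k =>
      (Pi.single (Sum.inr A) 1 : Fin n ⊕ Fin k → ℝ) (Sum.inr B)) = Pi.single A 1 := by
    funext B; simp [Pi.single_apply]
  have h0 : u.hor 0 = 0 := map_zero _
  rw [h1, h2, h0, zero_add]

lemma frame_isInvertible_iff (u : P.AdaptedTotal) :
    u.frame.IsInvertible ↔ ((P.dproj u.1).comp u.hor).IsInvertible ∧ u.vert.IsInvertible := by
  have happ : ∀ z, u.frame z = u.hor (fun i => z (Sum.inl i)) + P.vertIncl u.1 (u.vert fun i => z (Sum.inr i)) :=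
    fun z => rfl
  have hV : ∀ v, P.dproj u.1 (P.vertIncl u.1 v) = 0 := fun v => v.2
  constructor
  · intro h
    have hg : u.vert.IsInvertible := by
      refine isInvertible_of_injective ?_ (by rw [finrank_vertBundle]; simp)
      rw [injective_iff_map_eq_zero]
      intro y hy
      have h1 : u.frame (Sum.elim 0 y) = 0 := by
        rw [happ]
        have : (fun i : Fin n => Sum.elim (0 : Fin n → ℝ) y (Sum.inl i)) = 0 := rfl
        rw [this, map_zero, zero_add]
        have : (fun i : Fin k => Sum.elim (0 : Fin n → ℝ) y (Sum.inr i)) = y := rfl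
        rw [this, hy, map_zero]
      have h2 := h.injective (h1.trans (map_zero _).symm)
      funext A
      exact congrFun h2 (Sum.inr A)
    refine ⟨isInvertible_of_injective ?_ (by rw [finrank_pullTM]; simp), hg⟩
    rw [injective_iff_map_eq_zero]
    intro x hx
    have hx' : u.hor x ∈ P.vertical u.1 := hx
    obtain ⟨v, hv⟩ : ∃ v : P.VertBundle u.1, P.vertIncl u.1 v = u.hor x := ⟨(⟨_, hx'⟩ : P.vertical u.1), rfl⟩
    obtain ⟨y, hy⟩ := hg.surjective v
    have h1 : u.frame (Sum.elim x (-y)) = 0 := by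
      rw [happ]
      have : (fun i : Fin k => Sum.elim x (-y) (Sum.inr i)) = -y := rfl
      rw [this, map_neg, hy, map_neg, hv]
      exact add_neg_cancel (u.hor x)
    have h2 := h.injective (h1.trans (map_zero _).symm)
    funext i
    exact congrFun h2 (Sum.inl i)
  · rintro ⟨h1, h2⟩
    refine isInvertible_of_injective ?_ (by rw [finrank_tangentSpace]; simp)
    rw [injective_iff_map_eq_zero]
    intro z hz
    rw [happ] at hz
    have h3 : (fun i => z (Sum.inl i)) = 0 := by
      refine h1.injective ?_
      have := congrArg (P.dproj u.1) hz
      rw [map_add, hV, add_zero, map_zero] at this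
      rw [map_zero]
      exact this
    rw [h3, map_zero, zero_add] at hz
    have h4 : (fun i => z (Sum.inr i)) = 0 := by
      refine h2.injective ?_
      rw [map_zero]
      exact Subtype.ext hz
    funext α
    rcases α with i | A
    · exact congrFun h3 i
    · exact congrFun h4 A

lemma isOpen_adaptedFrames : IsOpen {u : P.AdaptedTotal | u.frame.IsInvertible} := by
  simp only [P.frame_isInvertible_iff]
  rw [isOpen_iff_forall_mem_open]
  intro u₀ hu₀
  let t₁ := trivializationAt ((Fin n → ℝ) →L[ℝ] EuclideanSpace ℝ (Fin (n + k)))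
    (fun e : E => Trivial E (Fin n → ℝ) e →L[ℝ] TangentSpace (𝓡 (n + k)) e) u₀.1
  let t₂ := trivializationAt ((Fin k → ℝ) →L[ℝ] EuclideanSpace ℝ (Fin k))
    (fun e : E => Trivial E (Fin k → ℝ) e →L[ℝ] P.VertBundle e) u₀.1
  let t := trivializationAt (((Fin n → ℝ) →L[ℝ] EuclideanSpace ℝ (Fin (n + k))) ×
      ((Fin k → ℝ) →L[ℝ] EuclideanSpace ℝ (Fin k)))
    ((fun e : E => Trivial E (Fin n → ℝ) e →L[ℝ] TangentSpace (𝓡 (n + k)) e) ×ᵇ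
      (fun e : E => Trivial E (Fin k → ℝ) e →L[ℝ] P.VertBundle e)) u₀.1
  let S : Set P.AdaptedTotal := t.source ∩ TotalSpace.proj ⁻¹' P.chartDom u₀.1
  have hS : IsOpen S := t.open_source.inter ((P.isOpen_chartDom u₀.1).preimage (FiberBundle.continuous_proj _ _))
  let F : P.AdaptedTotal → (Fin n → ℝ) →L[ℝ] EuclideanSpace ℝ (Fin n) :=
    fun u => (P.coordDproj u₀.1 u.1).comp (t u).2.1
  let G : P.AdaptedTotal → (Fin k → ℝ) →L[ℝ] EuclideanSpace ℝ (Fin k) := fun u => (t u).2.2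
  have hc : ContinuousOn t S := t.continuousOn.mono inter_subset_left
  have hF : ContinuousOn F S := by
    refine ContinuousOn.clm_comp ?_ (continuous_fst.comp_continuousOn (continuous_snd.comp_continuousOn hc))
    exact (P.contMDiffOn_coordDproj u₀.1).continuousOn.comp (FiberBundle.continuous_proj _ _).continuousOn
      (fun u hu => hu.2)
  have hG : ContinuousOn G S := continuous_snd.comp_continuousOn (continuous_snd.comp_continuousOn hc)
  have keyG : ∀ u ∈ S, ((G u).IsInvertible ↔ u.vert.IsInvertible) := by
    intro u hu
    have h1 : G u = ContinuousLinearMap.inCoordinates (Fin k → ℝ) (Trivial E (Fin k → ℝ))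
      (EuclideanSpace ℝ (Fin k)) P.VertBundle u₀.1 u.1 u₀.1 u.1 u.vert := rfl
    rw [h1, ContinuousLinearMap.inCoordinates_eq hu.1.2.1 hu.1.2.2]
    rw [ContinuousLinearMap.isInvertible_equiv_comp, ContinuousLinearMap.isInvertible_comp_equiv]
  have keyF : ∀ u ∈ S, ((F u).IsInvertible ↔ ((P.dproj u.1).comp u.hor).IsInvertible) := by
    intro u hu
    have h2 : F u = (((trivializationAt (EuclideanSpace ℝ (Fin n)) P.PullTM u₀.1).continuousLinearEquivAt ℝ u.1 hu.2.2 : P.PullTM u.1 →L[ℝ] EuclideanSpace ℝ (Fin n)).comp ((P.dproj u.1).comp u.hor)).comp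
       (((trivializationAt (Fin n → ℝ) (Trivial E (Fin n → ℝ)) u₀.1).continuousLinearEquivAt ℝ u.1 hu.1.1.1).symm : (Fin n → ℝ) →L[ℝ] (Fin n → ℝ)) := by
      refine ContinuousLinearMap.ext fun x => ?_
      have h3 := P.coordDproj_continuousLinearMapAt hu.2 (u.hor
        ((trivializationAt (Fin n → ℝ) (Trivial E (Fin n → ℝ)) u₀.1).symmL ℝ u.1 x))
      simp only [ContinuousLinearMap.comp_apply, ContinuousLinearEquiv.coe_coe,
        Trivialization.symm_continuousLinearEquivAt_eq, Trivialization.coe_continuousLinearEquivAt_eq]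
      exact h3
    rw [h2]
    rw [ContinuousLinearMap.isInvertible_comp_equiv, ContinuousLinearMap.isInvertible_equiv_comp]
  refine ⟨S ∩ (fun u => (F u, G u)) ⁻¹' ({f | f.IsInvertible} ×ˢ {f | f.IsInvertible}), ?_, ?_, ?_⟩
  · rintro u ⟨hu, h1, h2⟩
    exact ⟨(keyF u hu).1 h1, (keyG u hu).1 h2⟩
  · exact (hF.prodMk hG).isOpen_inter_preimage hS (ContinuousLinearEquiv.isOpen.prod ContinuousLinearEquiv.isOpen)
  · have hm : u₀ ∈ S := ⟨FiberBundle.mem_trivializationAt_proj_source, P.mem_chartDom u₀.1⟩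
    exact ⟨hm, (keyF u₀ hm).2 hu₀.1, (keyG u₀ hm).2 hu₀.2⟩


lemma linearIndependent_map_single {W : Type*} [AddCommGroup W] [Module ℝ W]
    (f : (Fin n ⊕ Fin k → ℝ) →ₗ[ℝ] W) (hf : Function.Injective f) :
    LinearIndependent ℝ (fun α => f (Pi.single α 1)) := by
  have h := (Pi.basisFun ℝ (Fin n ⊕ Fin k)).linearIndependent.map' f (LinearMap.ker_eq_bot.2 hf)
  convert! h using 1
  funext α
  simp

lemma linearIndependent_comb {W : Type*} [AddCommGroup W] [Module ℝ W] {v : Fin n ⊕ Fin k → W}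
    (hv : LinearIndependent ℝ v) {g : Matrix (Fin n ⊕ Fin k) (Fin n ⊕ Fin k) ℝ}
    (hg : IsUnit g.det) : LinearIndependent ℝ (fun β => ∑ α, g α β • v α) := by
  rw [Fintype.linearIndependent_iff] at hv ⊢
  intro x hx
  have h1 : ∑ α, (g.mulVec x) α • v α = 0 := by
    rw [← hx]
    simp only [Matrix.mulVec, dotProduct, Finset.sum_smul, Finset.smul_sum, smul_smul]
    rw [Finset.sum_comm]
    simp only [mul_comm]
  have h2 : g.mulVec x = 0 := funext (hv _ h1)
  have h3 : x = 0 := by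
    have := congrArg (g⁻¹.mulVec) h2
    rwa [Matrix.mulVec_mulVec, Matrix.nonsing_inv_mul g hg, Matrix.one_mulVec, Matrix.mulVec_zero] at this
  exact congrFun h3

lemma linearCombination_isInvertible (e : E) {v : Fin n ⊕ Fin k → TangentSpace (𝓡 (n + k)) e}
    (hv : LinearIndependent ℝ v) :
    (LinearMap.toContinuousLinearMap (Fintype.linearCombination ℝ v)).IsInvertible :=
  isInvertible_of_injective (hv.fintypeLinearCombination_injective)
    (by rw [finrank_tangentSpace]; simp)

variable (n k E) in
/-- The bundle of linear frames `LE`, an open submanifold of the bundle `Hom(ℝ^(n+k), TE)`: a frame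
`(e_i, e_A)` at `e` is the linear isomorphism `ℝ^(n+k) → T_e E` carrying the standard basis to it. -/
def linearFrameBundle : TopologicalSpace.Opens (FrameTotal n k E) :=
  ⟨{u | u.2.IsInvertible}, isOpen_frames n k E⟩

/-- The projection `λ : LE → E`. -/
def linearFrameProj (u : linearFrameBundle n k E) : E := u.1.1

/-- The frame given by a basis `v` of `T_e E`. -/
def linearFrameMk (e : E) (v : Fin n ⊕ Fin k → TangentSpace (𝓡 (n + k)) e) (hv : LinearIndependent ℝ v) :
    linearFrameBundle n k E :=
  ⟨⟨e, LinearMap.toContinuousLinearMap (Fintype.linearCombination ℝ v)⟩, linearCombination_isInvertible e hv⟩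

/-- The dual frame `(e^α)` of a frame, as a map `T_e E → ℝ^(n+k)`. -/
def linearCoframe (u : linearFrameBundle n k E) :
    TangentSpace (𝓡 (n + k)) (linearFrameProj u) →L[ℝ] (Fin n ⊕ Fin k → ℝ) :=
  ContinuousLinearMap.inverse u.1.2

/-- The `ℝ^(n+k)`-valued soldering 1-form on `LE`: `θ^α_u(X) = e^α(λ_* X)`. -/
def linearSoldering (u : linearFrameBundle n k E) :
    TangentSpace (linearFrameModel n k) u →L[ℝ] (Fin n ⊕ Fin k → ℝ) :=
  (linearCoframe u).comp (mfderiv (linearFrameModel n k) (𝓡 (n + k)) linearFrameProj u)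

/-- The adapted frame bundle `L_π E`: frames `(e_i, e_A)` of `E` with all `e_A` vertical, as an open
submanifold of the vector bundle `Hom(ℝ^n, TE) ⊕ Hom(ℝ^k, Vπ)`. -/
def adaptedFrameBundle : TopologicalSpace.Opens P.AdaptedTotal :=
  ⟨{u | u.frame.IsInvertible}, P.isOpen_adaptedFrames⟩

variable {P}

/-- The projection `λ : L_π E → E`. -/
def adaptedProj (u : P.adaptedFrameBundle) : E := u.1.1

/-- The vectors of an adapted frame `u = (e_i, e_A)`: `e_i = frameVec u (inl i)` and
`e_A = frameVec u (inr A)`. -/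
def frameVec (u : P.adaptedFrameBundle) (α : Fin n ⊕ Fin k) : TangentSpace (𝓡 (n + k)) (adaptedProj u) :=
  u.1.frame (Pi.single α 1)

lemma linearIndependent_frameVec (u : P.adaptedFrameBundle) : LinearIndependent ℝ (frameVec u) :=
  linearIndependent_map_single u.1.frame.toLinearMap u.2.injective

lemma frameVec_inr_mem (u : P.adaptedFrameBundle) (A : Fin k) :
    frameVec u (Sum.inr A) ∈ P.vertical (adaptedProj u) := by
  have h : frameVec u (Sum.inr A) = P.vertIncl u.1.1 (u.1.vert (Pi.single A 1)) :=
    u.1.frame_single_inr A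
  rw [h]
  exact (u.1.vert (Pi.single A 1)).2

variable (P) in
/-- The pair of linear maps `ℝ^n → T_e E`, `ℝ^k → V_e π` given by `v = (v_i, v_A)`, `v_A` vertical. -/
def adaptedTotalMk (e : E) (v : Fin n ⊕ Fin k → TangentSpace (𝓡 (n + k)) e)
    (hvert : ∀ A, v (Sum.inr A) ∈ P.vertical e) : P.AdaptedTotal :=
  ⟨e, LinearMap.toContinuousLinearMap (Fintype.linearCombination ℝ fun i => v (Sum.inl i)),
    LinearMap.toContinuousLinearMap (Fintype.linearCombination ℝ fun A =>
      (show P.VertBundle e from (⟨v (Sum.inr A), hvert A⟩ : P.vertical e)))⟩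

lemma frame_adaptedTotalMk (e : E) (v : Fin n ⊕ Fin k → TangentSpace (𝓡 (n + k)) e)
    (hvert : ∀ A, v (Sum.inr A) ∈ P.vertical e) :
    (P.adaptedTotalMk e v hvert).frame =
      LinearMap.toContinuousLinearMap (Fintype.linearCombination ℝ v) := by
  refine ContinuousLinearMap.ext fun z => ?_
  change (∑ i, z (Sum.inl i) • v (Sum.inl i)) + P.vertIncl e (∑ A, z (Sum.inr A) •
    (show P.VertBundle e from (⟨v (Sum.inr A), hvert A⟩ : P.vertical e))) = ∑ α, z α • v α
  rw [map_sum, Fintype.sum_sum_type]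
  congr 1

variable (P) in
/-- The adapted frame given by a basis `v = (v_i, v_A)` of `T_e E` with all `v_A` vertical. -/
def adaptedMk (e : E) (v : Fin n ⊕ Fin k → TangentSpace (𝓡 (n + k)) e)
    (hv : LinearIndependent ℝ v) (hvert : ∀ A, v (Sum.inr A) ∈ P.vertical e) :
    P.adaptedFrameBundle :=
  ⟨P.adaptedTotalMk e v hvert, by
    change ContinuousLinearMap.IsInvertible _
    rw [frame_adaptedTotalMk]
    exact linearCombination_isInvertible e hv⟩

lemma frameVec_adaptedMk (e : E) (v : Fin n ⊕ Fin k → TangentSpace (𝓡 (n + k)) e)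
    (hv : LinearIndependent ℝ v) (hvert : ∀ A, v (Sum.inr A) ∈ P.vertical e) :
    frameVec (P.adaptedMk e v hv hvert) = v := by
  funext α
  change (P.adaptedTotalMk e v hvert).frame (Pi.single α 1) = v α
  rw [frame_adaptedTotalMk]
  change Fintype.linearCombination ℝ v (Pi.single α 1) = v α
  simp

/-- The dual frame `(e^i, e^A)` of an adapted frame, as a map `T_e E → ℝ^(n+k)`. -/
def coframe (u : P.adaptedFrameBundle) :
    TangentSpace (𝓡 (n + k)) (adaptedProj u) →L[ℝ] (Fin n ⊕ Fin k → ℝ) :=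
  ContinuousLinearMap.inverse u.1.frame

/-- The soldering 1-form on `L_π E`, the restriction of that of `LE`: `θ^α_u(X) = e^α(λ_* X)`. -/
def soldering (u : P.adaptedFrameBundle) :
    TangentSpace (adaptedModel n k) u →L[ℝ] (Fin n ⊕ Fin k → ℝ) :=
  (coframe u).comp (mfderiv (adaptedModel n k) (𝓡 (n + k)) adaptedProj u)

/-- The right action `(u · g)_β = g^α_β e_α` on `L_π E` of an invertible block lower triangular
matrix `g`. -/
def adaptedAct (u : P.adaptedFrameBundle) (g : Matrix (Fin n ⊕ Fin k) (Fin n ⊕ Fin k) ℝ)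
    (hg : IsUnit g.det) (hblock : ∀ i A, g (Sum.inl i) (Sum.inr A) = 0) : P.adaptedFrameBundle :=
  P.adaptedMk (adaptedProj u) (fun β => ∑ α, g α β • frameVec u α)
    (linearIndependent_comb (linearIndependent_frameVec u) hg) (fun A => by
      rw [Fintype.sum_sum_type]
      simp only [hblock, zero_smul, Finset.sum_const_zero, zero_add]
      exact Submodule.sum_mem _ fun B _ => Submodule.smul_mem _ _ (frameVec_inr_mem u B))

/-- The standard basis element `E^i_A` of `gl(n + k, ℝ)`: `u · E^i_A` has `e_A` in place `i`. -/
def elemMat (i : Fin n) (A : Fin k) : Matrix (Fin n ⊕ Fin k) (Fin n ⊕ Fin k) ℝ :=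
  Matrix.single (Sum.inr A) (Sum.inl i) 1

lemma exp_smul_elemMat (i : Fin n) (A : Fin k) (t : ℝ) :
    NormedSpace.exp (t • elemMat i A) = 1 + t • elemMat i A := by
  have h2 : (t • elemMat i A) ^ 2 = 0 := by
    rw [pow_two]; simp [elemMat]
  have h3 : ∀ m, 2 ≤ m → (t • elemMat i A) ^ m = 0 := fun m hm => pow_eq_zero_of_le hm h2
  rw [NormedSpace.exp_eq_tsum ℝ]
  simp only
  rw [tsum_eq_sum (s := Finset.range 2)]
  · simp [Finset.sum_range_succ]
  · intro m hm
    rw [h3 m (by simp at hm; omega), smul_zero]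

/-- The derivative `E^{*i}_A(L)` of `L` along the fundamental vertical vector field
`E^{*i}_A(u) = d/dt (u · exp(t E^i_A))` at `t = 0`. -/
def vertDeriv (i : Fin n) (A : Fin k) (L : P.adaptedFrameBundle → ℝ) (u : P.adaptedFrameBundle) : ℝ :=
  deriv (fun t : ℝ => L (adaptedAct u (NormedSpace.exp (t • elemMat i A))
    ((Matrix.isUnit_iff_isUnit_det _).1 (Matrix.isUnit_exp _))
    (fun j B => by rw [exp_smul_elemMat]; simp [elemMat]))) 0

variable (P) in
/-- The manifold `Hom(π^* TM, TE)`. -/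
abbrev JetTotal : Type _ :=
  TotalSpace (EuclideanSpace ℝ (Fin n) →L[ℝ] EuclideanSpace ℝ (Fin (n + k)))
    (fun e : E => P.PullTM e →L[ℝ] TangentSpace (𝓡 (n + k)) e)

variable (P) in
/-- The first jet bundle `J^1 π`, the submanifold of `Hom(π^* TM, TE)` of the linear right inverses of
`π_*(e)`, `e ∈ E`. -/
def jetBundle : Set P.JetTotal :=
  {j | (P.dproj j.1).comp j.2 = ContinuousLinearMap.id ℝ (P.PullTM j.1)}

variable (n k) in
/-- The model of the manifold `Hom(π^* TM, TE)`. -/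
abbrev jetModel :=
  (𝓡 (n + k)).prod 𝓘(ℝ, EuclideanSpace ℝ (Fin n) →L[ℝ] EuclideanSpace ℝ (Fin (n + k)))

/-- Smooth functions on the embedded submanifold `J^1 π` of `Hom(π^* TM, TE)`: those that extend
locally to smooth functions on open sets of `Hom(π^* TM, TE)`. -/
def IsSmoothOnJets (f : P.jetBundle → ℝ) : Prop :=
  ∀ j₀ : P.jetBundle, ∃ U : Set P.JetTotal, IsOpen U ∧ (j₀ : P.JetTotal) ∈ U ∧
    ∃ F : P.JetTotal → ℝ, ContMDiffOn (jetModel n k) 𝓘(ℝ, ℝ) ∞ F U ∧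
      ∀ j : P.jetBundle, (j : P.JetTotal) ∈ U → F j = f j

/-- The projection `ρ : L_π E → J^1 π`, sending `(e_i, e_A)` to the linear map `π_* e_i ↦ e_i`; see
`jetProj_apply`. -/
def jetProj (u : P.adaptedFrameBundle) : P.jetBundle :=
  ⟨⟨adaptedProj u, u.1.hor.comp ((P.dproj (adaptedProj u)).comp u.1.hor).inverse⟩, by
    have h := ((P.frame_isInvertible_iff u.1).1 u.2).1
    exact h.self_comp_inverse⟩

lemma jetProj_apply (u : P.adaptedFrameBundle) (i : Fin n) :
    (jetProj u).1.2 (P.dproj (adaptedProj u) (frameVec u (Sum.inl i))) = frameVec u (Sum.inl i) := by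
  have h := ((P.frame_isInvertible_iff u.1).1 u.2).1
  have hv : frameVec u (Sum.inl i) = u.1.hor (Pi.single i 1) := u.1.frame_single_inl i
  rw [hv]
  exact congrArg u.1.hor (h.inverse_apply_self (Pi.single i 1))

/-- The pull-up `ρ^* f` to `L_π E` of a function `f` on `J^1 π`. -/
def pullUp (f : P.jetBundle → ℝ) (u : P.adaptedFrameBundle) : ℝ := f (jetProj u)

/-- The vectors `e_i / (τ L)` and `e_A - (1 / (τ L)) E^{*a}_A(L) e_a`, where `τ = τ(n)`. -/
def legendreVec (τ : ℕ → ℝ) (L : P.adaptedFrameBundle → ℝ) (u : P.adaptedFrameBundle) :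
    Fin n ⊕ Fin k → TangentSpace (𝓡 (n + k)) (adaptedProj u) :=
  Sum.elim (fun i => (1 / (τ n * L u)) • frameVec u (Sum.inl i))
    (fun A => frameVec u (Sum.inr A) -
      ∑ a, ((1 / (τ n * L u)) * vertDeriv a A L u) • frameVec u (Sum.inl a))

lemma linearIndependent_legendreVec {τ : ℕ → ℝ} (hτ : 0 < τ n) {L : P.adaptedFrameBundle → ℝ}
    {u : P.adaptedFrameBundle} (hL : L u ≠ 0) : LinearIndependent ℝ (legendreVec τ L u) := by
  let g : Matrix (Fin n ⊕ Fin k) (Fin n ⊕ Fin k) ℝ := Matrix.fromBlocks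
    ((1 / (τ n * L u)) • 1) (Matrix.of fun a A => -((1 / (τ n * L u)) * vertDeriv a A L u)) 0 1
  have hg : IsUnit g.det := by
    have h0 : τ n * L u ≠ 0 := mul_ne_zero hτ.ne' hL
    rw [Matrix.det_fromBlocks_zero₂₁, Matrix.det_smul]
    simp [hτ.ne', hL]
  convert! linearIndependent_comb (linearIndependent_frameVec u) hg using 1
  funext β
  rw [Fintype.sum_sum_type]
  rcases β with i | A
  · simp [g, legendreVec, Matrix.one_apply]
  · simp [g, legendreVec, Matrix.one_apply, sub_eq_neg_add]

/-- The `m`-symplectic Legendre transformation `φ_L : L_π E → LE` of a non-vanishing `L`. -/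
def legendre {τ : ℕ → ℝ} (hτ : 0 < τ n) {L : P.adaptedFrameBundle → ℝ} (hL : ∀ u, L u ≠ 0)
    (u : P.adaptedFrameBundle) : linearFrameBundle n k E :=
  linearFrameMk (adaptedProj u) (legendreVec τ L u) (linearIndependent_legendreVec hτ (hL u))

/-- The `ℝ^(n+k)`-valued Cartan-Hamilton-Poincaré 1-form on `L_π E`:
`θ^i_L = τ(n) L θ^i + E^{*i}_A(L) θ^A` and `θ^A_L = θ^A`. -/
def chpForm (τ : ℕ → ℝ) (L : P.adaptedFrameBundle → ℝ) (u : P.adaptedFrameBundle) :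
    TangentSpace (adaptedModel n k) u →L[ℝ] (Fin n ⊕ Fin k → ℝ) :=
  let θ : Fin n ⊕ Fin k → TangentSpace (adaptedModel n k) u →L[ℝ] ℝ :=
    fun α => (ContinuousLinearMap.proj α).comp (soldering u)
  ContinuousLinearMap.pi (Sum.elim
    (fun i => (τ n * L u) • θ (Sum.inl i) + ∑ A, vertDeriv i A L u • θ (Sum.inr A))
    (fun A => θ (Sum.inr A)))

end FiberedManifold

end

/-!
An adapted frame is an isomorphism `ℝ^(n+k) → T_e E`, and `φ_L` composes it with the invertible
block triangular matrix `g(u)` whose blocks are `1/(τL)`, `-E^*(L)/(τL)`, `0` and `1`. Dual frames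
are inverses, so the dual of `φ_L(u)` is `g(u)⁻¹` times the dual of `u`; since `λ ∘ φ_L = λ`, the
soldering form pulls back to `g(u)⁻¹ θ`, and `g(u)⁻¹` is the coefficient matrix of `θ_L`.

Smoothness can be tested in `Hom(ℝ^(n+k), TE)`, where matrices act by composition: `exp(t E^i_A)` is
`1 + t E^i_A`, so `E^{*i}_A(L)` is a parametric derivative of a smooth function, and `φ_L` is the
product of the inclusion `L_π E → LE` with the smooth matrix-valued function `g`.
-/

noncomputable section

section HomBundle

variable {𝕜 B N F₁ F₂ F₃ : Type*} [NontriviallyNormedField 𝕜] {r : WithTop ℕ∞}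
  {E₁ : B → Type*} [∀ x, AddCommGroup (E₁ x)] [∀ x, Module 𝕜 (E₁ x)] [NormedAddCommGroup F₁]
  [NormedSpace 𝕜 F₁] [TopologicalSpace (TotalSpace F₁ E₁)] [∀ x, TopologicalSpace (E₁ x)]
  {E₂ : B → Type*} [∀ x, AddCommGroup (E₂ x)] [∀ x, Module 𝕜 (E₂ x)] [NormedAddCommGroup F₂]
  [NormedSpace 𝕜 F₂] [TopologicalSpace (TotalSpace F₂ E₂)] [∀ x, TopologicalSpace (E₂ x)]
  {E₃ : B → Type*} [∀ x, AddCommGroup (E₃ x)] [∀ x, Module 𝕜 (E₃ x)] [NormedAddCommGroup F₃]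
  [NormedSpace 𝕜 F₃] [TopologicalSpace (TotalSpace F₃ E₃)] [∀ x, TopologicalSpace (E₃ x)]
  {EB HB : Type*} [NormedAddCommGroup EB] [NormedSpace 𝕜 EB] [TopologicalSpace HB]
  {IB : ModelWithCorners 𝕜 EB HB} [TopologicalSpace B] [ChartedSpace HB B]
  {EN HN : Type*} [NormedAddCommGroup EN] [NormedSpace 𝕜 EN] [TopologicalSpace HN]
  {IN : ModelWithCorners 𝕜 EN HN} [TopologicalSpace N] [ChartedSpace HN N]
  [FiberBundle F₁ E₁] [VectorBundle 𝕜 F₁ E₁] [FiberBundle F₂ E₂] [VectorBundle 𝕜 F₂ E₂]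
  [FiberBundle F₃ E₃] [VectorBundle 𝕜 F₃ E₃]
  {b : N → B} {x₀ : N}

lemma eventually_mem_baseSet_trivializationAt {F : Type*} [TopologicalSpace F] {E : B → Type*}
    [TopologicalSpace (TotalSpace F E)] [∀ x, TopologicalSpace (E x)] [FiberBundle F E]
    {N : Type*} [TopologicalSpace N] {b : N → B} {x₀ : N} (hb : ContinuousAt b x₀) :
    ∀ᶠ x in 𝓝 x₀, b x ∈ (trivializationAt F E (b x₀)).baseSet :=
  hb ((trivializationAt F E (b x₀)).open_baseSet.mem_nhds
    (FiberBundle.mem_baseSet_trivializationAt' (b x₀)))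

lemma inCoordinates_trivial (x₀ x : B) (φ : F₁ →L[𝕜] F₂) :
    ContinuousLinearMap.inCoordinates F₁ (Trivial B F₁) F₂ (Trivial B F₂) x₀ x x₀ x φ = φ := by
  ext v
  simp [ContinuousLinearMap.inCoordinates, Trivial.continuousLinearMapAt_trivialization,
    Trivial.symmL_trivialization]

lemma contMDiffAt_hom_trivial_iff {φ : N → F₁ →L[𝕜] F₂} :
    ContMDiffAt IN (IB.prod 𝓘(𝕜, F₁ →L[𝕜] F₂)) r
      (fun x => TotalSpace.mk' (F₁ →L[𝕜] F₂)
        (E := fun y : B => Trivial B F₁ y →L[𝕜] Trivial B F₂ y) (b x) (φ x)) x₀ ↔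
      ContMDiffAt IN IB r b x₀ ∧ ContMDiffAt IN 𝓘(𝕜, F₁ →L[𝕜] F₂) r φ x₀ := by
  rw [contMDiffAt_hom_bundle]
  simp only [TotalSpace.mk']
  simp only [inCoordinates_trivial]

variable [∀ x, IsTopologicalAddGroup (E₂ x)] [∀ x, ContinuousSMul 𝕜 (E₂ x)]
  {φ φ' : ∀ x, E₁ (b x) →L[𝕜] E₂ (b x)}

lemma contMDiffAt_hom_add
    (hφ : ContMDiffAt IN (IB.prod 𝓘(𝕜, F₁ →L[𝕜] F₂)) r
      (fun x => TotalSpace.mk' (F₁ →L[𝕜] F₂) (E := fun y => E₁ y →L[𝕜] E₂ y) (b x) (φ x)) x₀)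
    (hφ' : ContMDiffAt IN (IB.prod 𝓘(𝕜, F₁ →L[𝕜] F₂)) r
      (fun x => TotalSpace.mk' (F₁ →L[𝕜] F₂) (E := fun y => E₁ y →L[𝕜] E₂ y) (b x) (φ' x)) x₀) :
    ContMDiffAt IN (IB.prod 𝓘(𝕜, F₁ →L[𝕜] F₂)) r
      (fun x => TotalSpace.mk' (F₁ →L[𝕜] F₂) (E := fun y => E₁ y →L[𝕜] E₂ y)
        (b x) (φ x + φ' x)) x₀ := by
  rw [contMDiffAt_hom_bundle] at hφ hφ' ⊢
  refine ⟨hφ.1, (hφ.2.add hφ'.2).congr_of_eventuallyEq (.of_forall fun x => ?_)⟩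
  simp only [ContinuousLinearMap.inCoordinates, ContinuousLinearMap.add_comp,
    ContinuousLinearMap.comp_add, Pi.add_apply]

lemma contMDiffAt_hom_inverse [∀ x, IsTopologicalAddGroup (E₁ x)] [∀ x, ContinuousSMul 𝕜 (E₁ x)]
    [CompleteSpace F₁]
    (hφ : ContMDiffAt IN (IB.prod 𝓘(𝕜, F₁ →L[𝕜] F₂)) r
      (fun x => TotalSpace.mk' (F₁ →L[𝕜] F₂) (E := fun y => E₁ y →L[𝕜] E₂ y) (b x) (φ x)) x₀)
    (hinv : (φ x₀).IsInvertible) :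
    ContMDiffAt IN (IB.prod 𝓘(𝕜, F₂ →L[𝕜] F₁)) r
      (fun x => TotalSpace.mk' (F₂ →L[𝕜] F₁) (E := fun y => E₂ y →L[𝕜] E₁ y)
        (b x) (φ x).inverse) x₀ := by
  rw [contMDiffAt_hom_bundle] at hφ ⊢
  obtain ⟨hb, hφ⟩ := hφ
  have hinv' : (ContinuousLinearMap.inCoordinates F₁ E₁ F₂ E₂ (b x₀) (b x₀) (b x₀) (b x₀)
      (φ x₀)).IsInvertible := by
    rw [ContinuousLinearMap.inCoordinates_eq (FiberBundle.mem_baseSet_trivializationAt' _)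
      (FiberBundle.mem_baseSet_trivializationAt' _), ContinuousLinearMap.isInvertible_equiv_comp,
      ContinuousLinearMap.isInvertible_comp_equiv]
    exact hinv
  refine ⟨hb, (hinv'.contDiffAt_map_inverse.contMDiffAt.comp x₀ hφ).congr_of_eventuallyEq ?_⟩
  filter_upwards [eventually_mem_baseSet_trivializationAt (F := F₁) (E := E₁) hb.continuousAt,
    eventually_mem_baseSet_trivializationAt (F := F₂) (E := E₂) hb.continuousAt] with x h₁ h₂
  simp only [Function.comp_apply]
  rw [ContinuousLinearMap.inCoordinates_eq h₁ h₂, ContinuousLinearMap.inCoordinates_eq h₂ h₁,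
    ContinuousLinearMap.inverse_equiv_comp, ContinuousLinearMap.inverse_comp_equiv]
  rfl

lemma contMDiffAt_hom_comp [∀ x, IsTopologicalAddGroup (E₃ x)] [∀ x, ContinuousSMul 𝕜 (E₃ x)]
    {ψ : ∀ x, E₂ (b x) →L[𝕜] E₃ (b x)}
    (hψ : ContMDiffAt IN (IB.prod 𝓘(𝕜, F₂ →L[𝕜] F₃)) r
      (fun x => TotalSpace.mk' (F₂ →L[𝕜] F₃) (E := fun y => E₂ y →L[𝕜] E₃ y) (b x) (ψ x)) x₀)
    (hφ : ContMDiffAt IN (IB.prod 𝓘(𝕜, F₁ →L[𝕜] F₂)) r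
      (fun x => TotalSpace.mk' (F₁ →L[𝕜] F₂) (E := fun y => E₁ y →L[𝕜] E₂ y) (b x) (φ x)) x₀) :
    ContMDiffAt IN (IB.prod 𝓘(𝕜, F₁ →L[𝕜] F₃)) r
      (fun x => TotalSpace.mk' (F₁ →L[𝕜] F₃) (E := fun y => E₁ y →L[𝕜] E₃ y)
        (b x) ((ψ x).comp (φ x))) x₀ := by
  rw [contMDiffAt_hom_bundle] at hφ hψ ⊢
  refine ⟨hφ.1, (hψ.2.clm_comp hφ.2).congr_of_eventuallyEq ?_⟩
  filter_upwards [eventually_mem_baseSet_trivializationAt (F := F₂) (E := E₂)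
    hφ.1.continuousAt] with x hx
  ext v
  simp only [ContinuousLinearMap.inCoordinates, ContinuousLinearMap.comp_apply]
  rw [Trivialization.symmL_continuousLinearMapAt _ hx]

lemma contMDiffAt_hom_comp_of_trivial {φ : ∀ x, Trivial B F₁ (b x) →L[𝕜] E₂ (b x)}
    {ψ : N → F₃ →L[𝕜] F₁}
    (hφ : ContMDiffAt IN (IB.prod 𝓘(𝕜, F₁ →L[𝕜] F₂)) r
      (fun x => TotalSpace.mk' (F₁ →L[𝕜] F₂)
        (E := fun y => Trivial B F₁ y →L[𝕜] E₂ y) (b x) (φ x)) x₀)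
    (hψ : ContMDiffAt IN 𝓘(𝕜, F₃ →L[𝕜] F₁) r ψ x₀) :
    ContMDiffAt IN (IB.prod 𝓘(𝕜, F₃ →L[𝕜] F₂)) r
      (fun x => TotalSpace.mk' (F₃ →L[𝕜] F₂)
        (E := fun y => Trivial B F₃ y →L[𝕜] E₂ y) (b x) ((φ x).comp (ψ x))) x₀ :=
  contMDiffAt_hom_comp hφ
    (contMDiffAt_hom_trivial_iff.2 ⟨((contMDiffAt_hom_bundle _).1 hφ).1, hψ⟩)

end HomBundle

section ProdBundle

variable {𝕜 B N F₁ F₂ : Type*} [NontriviallyNormedField 𝕜] {r : WithTop ℕ∞}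
  [NormedAddCommGroup F₁] [NormedSpace 𝕜 F₁] [NormedAddCommGroup F₂] [NormedSpace 𝕜 F₂]
  {EB HB : Type*} [NormedAddCommGroup EB] [NormedSpace 𝕜 EB] [TopologicalSpace HB]
  {IB : ModelWithCorners 𝕜 EB HB} [TopologicalSpace B] [ChartedSpace HB B]
  {EN HN : Type*} [NormedAddCommGroup EN] [NormedSpace 𝕜 EN] [TopologicalSpace HN]
  {IN : ModelWithCorners 𝕜 EN HN} [TopologicalSpace N] [ChartedSpace HN N]
  {E₁ : B → Type*} [∀ x, AddCommGroup (E₁ x)] [TopologicalSpace (TotalSpace F₁ E₁)]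
  [∀ x, TopologicalSpace (E₁ x)] [FiberBundle F₁ E₁]
  {E₂ : B → Type*} [∀ x, AddCommGroup (E₂ x)] [TopologicalSpace (TotalSpace F₂ E₂)]
  [∀ x, TopologicalSpace (E₂ x)] [FiberBundle F₂ E₂]

lemma contMDiffAt_prod_bundle_iff {f : N → TotalSpace (F₁ × F₂) (E₁ ×ᵇ E₂)} {x₀ : N} :
    ContMDiffAt IN (IB.prod 𝓘(𝕜, F₁ × F₂)) r f x₀ ↔
      ContMDiffAt IN (IB.prod 𝓘(𝕜, F₁)) r
        (fun x => TotalSpace.mk' F₁ (E := E₁) (f x).1 (f x).2.1) x₀ ∧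
      ContMDiffAt IN (IB.prod 𝓘(𝕜, F₂)) r
        (fun x => TotalSpace.mk' F₂ (E := E₂) (f x).1 (f x).2.2) x₀ := by
  simp only [contMDiffAt_totalSpace, contMDiffAt_prod_module_iff]
  exact and_and_left

end ProdBundle

lemma contMDiffAt_opens_iff {𝕜 : Type*} [NontriviallyNormedField 𝕜]
    {EN HN N EX HX X : Type*} [NormedAddCommGroup EN] [NormedSpace 𝕜 EN] [TopologicalSpace HN]
    {IN : ModelWithCorners 𝕜 EN HN} [TopologicalSpace N] [ChartedSpace HN N]
    [NormedAddCommGroup EX] [NormedSpace 𝕜 EX] [TopologicalSpace HX]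
    {IX : ModelWithCorners 𝕜 EX HX} [TopologicalSpace X] [ChartedSpace HX X]
    {r : WithTop ℕ∞} {U : TopologicalSpace.Opens X} {f : N → U} {x₀ : N} :
    ContMDiffAt IN IX r f x₀ ↔ ContMDiffAt IN IX r (fun x => (f x : X)) x₀ := by
  rw [contMDiffAt_iff, contMDiffAt_iff, Topology.IsInducing.subtypeVal.continuousAt_iff]
  exact Iff.rfl

section ParametricDeriv

variable {𝕜 : Type*} [NontriviallyNormedField 𝕜]
  {EN HN N F : Type*} [NormedAddCommGroup EN] [NormedSpace 𝕜 EN] [TopologicalSpace HN]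
  {IN : ModelWithCorners 𝕜 EN HN} [TopologicalSpace N] [ChartedSpace HN N]
  [NormedAddCommGroup F] [NormedSpace 𝕜 F] {m r : WithTop ℕ∞} {f : N → 𝕜 → F} {x₀ : N} {t₀ : 𝕜}

lemma contMDiffAt_deriv_param [IsManifold IN 1 N]
    (hf : ContMDiffAt (IN.prod 𝓘(𝕜, 𝕜)) 𝓘(𝕜, F) r (Function.uncurry f) (x₀, t₀))
    (hmr : m + 1 ≤ r) : ContMDiffAt IN 𝓘(𝕜, F) m (fun x => deriv (f x) t₀) x₀ := by
  have h := ContMDiffAt.mfderiv (I := 𝓘(𝕜, 𝕜)) (I' := 𝓘(𝕜, F)) f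
    (fun _ => t₀) hf contMDiffAt_const hmr
  simpa only [inTangentCoordinates_model_space, mfderiv_eq_fderiv, fderiv_apply_one_eq_deriv] using
    h.clm_apply (contMDiffAt_const (c := (1 : 𝕜)))

end ParametricDeriv

lemma linearCombination_sum_smul_single {R ι κ W : Type*} [CommSemiring R] [Fintype ι]
    [Fintype κ] [DecidableEq ι] [DecidableEq κ] [AddCommMonoid W] [Module R W]
    (f : (ι → R) →ₗ[R] W) (g : Matrix ι κ R) :
    Fintype.linearCombination R (fun β => ∑ α, g α β • f (Pi.single α 1)) = f ∘ₗ g.toLin' := by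
  refine LinearMap.pi_ext' fun β => LinearMap.ext_ring ?_
  have hcol : g.col β = ∑ α, g α β • Pi.single α 1 := pi_eq_sum_univ' _
  simp [hcol]

section Matrix

variable {𝕜 : Type*} [NontriviallyNormedField 𝕜] [CompleteSpace 𝕜]
  {EN HN N : Type*} [NormedAddCommGroup EN] [NormedSpace 𝕜 EN] [TopologicalSpace HN]
  {IN : ModelWithCorners 𝕜 EN HN} [TopologicalSpace N] [ChartedSpace HN N] {r : WithTop ℕ∞}
  {ι κ : Type*} [Fintype ι] [Fintype κ] [DecidableEq κ]

lemma contMDiffAt_toLin' {g : N → Matrix ι κ 𝕜} {x₀ : N}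
    (hg : ∀ i j, ContMDiffAt IN 𝓘(𝕜, 𝕜) r (fun x => g x i j) x₀) :
    ContMDiffAt IN 𝓘(𝕜, (κ → 𝕜) →L[𝕜] (ι → 𝕜)) r
      (fun x => (g x).toLin'.toContinuousLinearMap) x₀ := by
  classical
  have h : ∀ x, (g x).toLin'.toContinuousLinearMap = ∑ i, ∑ j, g x i j •
      (Matrix.single i j (1 : 𝕜)).toLin'.toContinuousLinearMap := fun x => by
    conv_lhs => rw [Matrix.matrix_eq_sum_single (g x)]
    simp only [map_sum, ← map_smul, Matrix.smul_single, smul_eq_mul, mul_one]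
  simp only [h]
  exact contMDiffAt_finsetSum fun i _ => contMDiffAt_finsetSum fun j _ =>
    (hg i j).smul contMDiffAt_const

lemma inverse_toLin'_of_mul_eq_one [DecidableEq ι] {g h : Matrix ι ι 𝕜} (hgh : g * h = 1) :
    g.toLin'.toContinuousLinearMap.inverse = h.toLin'.toContinuousLinearMap := by
  have hcomp {g h : Matrix ι ι 𝕜} (hgh : g * h = 1) :
      g.toLin'.toContinuousLinearMap.comp h.toLin'.toContinuousLinearMap = .id 𝕜 _ := by
    ext1 z
    exact DFunLike.congr_fun ((Matrix.toLin'_mul g h).symm.trans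
      ((congrArg _ hgh).trans Matrix.toLin'_one)) z
  exact ContinuousLinearMap.inverse_eq (hcomp hgh) (hcomp (mul_eq_one_comm.1 hgh))

end Matrix

namespace FiberedManifold

variable {n k : ℕ} {E M : Type*}
  [TopologicalSpace M] [ChartedSpace (EuclideanSpace ℝ (Fin n)) M] [IsManifold (𝓡 n) ∞ M]
  [TopologicalSpace E] [ChartedSpace (EuclideanSpace ℝ (Fin (n + k))) E]
  [IsManifold (𝓡 (n + k)) ∞ E]
  {P : FiberedManifold n k E M}
  {EN HN N : Type*} [NormedAddCommGroup EN] [NormedSpace ℝ EN] [TopologicalSpace HN]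
  {IN : ModelWithCorners ℝ EN HN} [TopologicalSpace N] [ChartedSpace HN N]
  {m : ℕ∞} {x₀ : N}

variable (P) in
lemma contMDiff_dproj :
    ContMDiff (𝓡 (n + k)) ((𝓡 (n + k)).prod
      𝓘(ℝ, EuclideanSpace ℝ (Fin (n + k)) →L[ℝ] EuclideanSpace ℝ (Fin n))) ∞
      (fun e => TotalSpace.mk' (EuclideanSpace ℝ (Fin (n + k)) →L[ℝ] EuclideanSpace ℝ (Fin n))
        (E := fun e : E => TangentSpace (𝓡 (n + k)) e →L[ℝ] P.PullTM e) e (P.dproj e)) := fun e =>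
  (contMDiffAt_hom_bundle _).2
    ⟨contMDiffAt_id, (P.proj.contMDiff e).mfderiv_const (by simp)⟩

lemma symmL_vertBundle {e₀ e : E} (he : e ∈ P.vertDom e₀) (w : EuclideanSpace ℝ (Fin k)) :
    (trivializationAt (EuclideanSpace ℝ (Fin k)) P.VertBundle e₀).symmL ℝ e w =
      P.vertSymm e₀ e w := by
  rw [Trivialization.symmL_apply _ he]
  exact Pretrivialization.symm_apply (P.vertPretriv e₀) he w

variable (P) in
lemma contMDiff_vertIncl :
    ContMDiff (𝓡 (n + k)) ((𝓡 (n + k)).prod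
      𝓘(ℝ, EuclideanSpace ℝ (Fin k) →L[ℝ] EuclideanSpace ℝ (Fin (n + k)))) ∞
      (fun e => TotalSpace.mk' (EuclideanSpace ℝ (Fin k) →L[ℝ] EuclideanSpace ℝ (Fin (n + k)))
        (E := fun e : E => P.VertBundle e →L[ℝ] TangentSpace (𝓡 (n + k)) e) e
        (P.vertIncl e)) := fun e₀ => by
  -- In the trivializations at `e₀` the inclusion is `w ↦ splitting⁻¹ (0, w)`.
  have hvert : P.vertDom e₀ ∈ 𝓝 e₀ := (P.isOpen_vertDom e₀).mem_nhds (P.mem_vertDom e₀)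
  refine (contMDiffAt_hom_bundle _).2 ⟨contMDiffAt_id,
    (((P.contMDiffOn_inverse_splitting e₀).contMDiffAt hvert).clm_comp (contMDiffAt_const
      (c := ContinuousLinearMap.inr ℝ _ _))).congr_of_eventuallyEq ?_⟩
  filter_upwards [hvert] with e he
  ext1 w
  simp only [ContinuousLinearMap.inCoordinates, ContinuousLinearMap.comp_apply]
  rw [symmL_vertBundle he, P.vertIncl_vertSymm he,
    Trivialization.continuousLinearMapAt_symmL _ he.1.1]
  rfl

lemma contMDiffAt_vertIncl_comp_iff {F : Type*} [NormedAddCommGroup F] [NormedSpace ℝ F]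
    {b : N → E} {φ : ∀ x, Trivial E F (b x) →L[ℝ] P.VertBundle (b x)} :
    ContMDiffAt IN ((𝓡 (n + k)).prod 𝓘(ℝ, F →L[ℝ] EuclideanSpace ℝ (Fin (n + k)))) m
      (fun x => TotalSpace.mk' (F →L[ℝ] EuclideanSpace ℝ (Fin (n + k)))
        (E := fun e : E => Trivial E F e →L[ℝ] TangentSpace (𝓡 (n + k)) e) (b x)
        ((P.vertIncl (b x)).comp (φ x))) x₀ ↔
    ContMDiffAt IN ((𝓡 (n + k)).prod 𝓘(ℝ, F →L[ℝ] EuclideanSpace ℝ (Fin k))) m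
      (fun x => TotalSpace.mk' (F →L[ℝ] EuclideanSpace ℝ (Fin k))
        (E := fun e : E => Trivial E F e →L[ℝ] P.VertBundle e) (b x) (φ x)) x₀ := by
  constructor
  · intro h
    obtain ⟨hb, h⟩ := (contMDiffAt_hom_bundle _).1 h
    refine (contMDiffAt_hom_bundle _).2 ⟨hb, ((contMDiffAt_const
      (c := P.compl (b x₀))).clm_comp h).congr_of_eventuallyEq ?_⟩
    filter_upwards [hb.continuousAt ((P.isOpen_vertDom (b x₀)).mem_nhds (P.mem_vertDom (b x₀)))]
      with x hx
    ext1 z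
    simp only [ContinuousLinearMap.inCoordinates, ContinuousLinearMap.comp_apply]
    rw [Trivialization.continuousLinearMapAt_apply, Trivialization.coe_linearMapAt_of_mem _ hx]
    rfl
  · intro h
    have hb : ContMDiffAt IN (𝓡 (n + k)) m b x₀ := ((contMDiffAt_hom_bundle _).1 h).1
    exact contMDiffAt_hom_comp
      (((P.contMDiff_vertIncl _).of_le (by exact_mod_cast le_top)).comp x₀ hb) h

/-- The inclusion of `Hom(ℝ^n, TE) ⊕ Hom(ℝ^k, Vπ)` in `Hom(ℝ^(n+k), TE)`; it restricts to the
inclusion of `L_π E` in `LE`. -/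
def AdaptedTotal.toFrameTotal (u : P.AdaptedTotal) : FrameTotal n k E := ⟨u.1, u.frame⟩

lemma AdaptedTotal.hor_eq_frame_comp (u : P.AdaptedTotal) :
    u.hor = u.frame.comp (ContinuousLinearMap.pi (Sum.elim ContinuousLinearMap.proj 0)) := by
  ext1 z
  have h0 : u.vert 0 = 0 := map_zero _
  change u.hor z = u.hor z + P.vertIncl u.1 (u.vert 0)
  rw [h0, map_zero, add_zero]

lemma AdaptedTotal.vertIncl_comp_vert (u : P.AdaptedTotal) :
    (P.vertIncl u.1).comp u.vert =
      u.frame.comp (ContinuousLinearMap.pi (Sum.elim 0 ContinuousLinearMap.proj)) := by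
  ext1 z
  have h0 : u.hor 0 = 0 := map_zero _
  change P.vertIncl u.1 (u.vert z) = u.hor 0 + P.vertIncl u.1 (u.vert z)
  rw [h0, zero_add]

lemma contMDiffAt_toFrameTotal_iff {f : N → P.AdaptedTotal} :
    ContMDiffAt IN (linearFrameModel n k) m (fun x => (f x).toFrameTotal) x₀ ↔
      ContMDiffAt IN (adaptedModel n k) m f x₀ := by
  rw [contMDiffAt_prod_bundle_iff, ← contMDiffAt_vertIncl_comp_iff]
  constructor
  · intro h
    have hhor := contMDiffAt_hom_comp_of_trivial h (contMDiffAt_const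
      (c := .pi (Sum.elim (.proj (R := ℝ) (φ := fun _ : Fin n => ℝ)) 0)))
    have hvert := contMDiffAt_hom_comp_of_trivial h (contMDiffAt_const
      (c := .pi (Sum.elim 0 (.proj (R := ℝ) (φ := fun _ : Fin k => ℝ)))))
    exact ⟨hhor.congr_of_eventuallyEq (.of_forall fun x =>
        congrArg (TotalSpace.mk _) (f x).hor_eq_frame_comp),
      hvert.congr_of_eventuallyEq (.of_forall fun x =>
        congrArg (TotalSpace.mk _) (f x).vertIncl_comp_vert)⟩
  · rintro ⟨hhor, hvert⟩
    have hhor' := contMDiffAt_hom_comp_of_trivial hhor (contMDiffAt_const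
      (c := .pi fun i : Fin n => .proj (R := ℝ) (φ := fun _ : Fin n ⊕ Fin k => ℝ) (Sum.inl i)))
    have hvert' := contMDiffAt_hom_comp_of_trivial hvert (contMDiffAt_const
      (c := .pi fun A : Fin k => .proj (R := ℝ) (φ := fun _ : Fin n ⊕ Fin k => ℝ) (Sum.inr A)))
    exact contMDiffAt_hom_add hhor' hvert'

lemma contMDiff_toFrameTotal :
    ContMDiff (adaptedModel n k) (linearFrameModel n k) m
      (fun u : P.adaptedFrameBundle => u.1.toFrameTotal) := fun u =>
  contMDiffAt_toFrameTotal_iff.2 (contMDiff_subtype_val u)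

lemma contMDiff_hor :
    ContMDiff (adaptedModel n k)
      ((𝓡 (n + k)).prod 𝓘(ℝ, (Fin n → ℝ) →L[ℝ] EuclideanSpace ℝ (Fin (n + k)))) m
      (fun u : P.adaptedFrameBundle =>
        TotalSpace.mk' ((Fin n → ℝ) →L[ℝ] EuclideanSpace ℝ (Fin (n + k)))
          (E := fun e : E => Trivial E (Fin n → ℝ) e →L[ℝ] TangentSpace (𝓡 (n + k)) e)
          (adaptedProj u) u.1.hor) := fun u =>
  (contMDiffAt_prod_bundle_iff.1 (contMDiff_subtype_val u)).1

lemma contMDiff_adaptedProj :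
    ContMDiff (adaptedModel n k) (𝓡 (n + k)) m (adaptedProj (P := P)) :=
  (contMDiff_proj _).comp contMDiff_subtype_val

lemma contMDiff_jetProj : ContMDiff (adaptedModel n k) (jetModel n k) m
    (fun u : P.adaptedFrameBundle => (jetProj u : P.JetTotal)) := fun u =>
  contMDiffAt_hom_comp (contMDiff_hor u) (contMDiffAt_hom_inverse
    (contMDiffAt_hom_comp (((P.contMDiff_dproj.of_le (by exact_mod_cast le_top)).comp
      contMDiff_adaptedProj) u) (contMDiff_hor u)) ((P.frame_isInvertible_iff u.1).1 u.2).1)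

lemma contMDiff_pullUp {f : P.jetBundle → ℝ} (hf : IsSmoothOnJets f) :
    ContMDiff (adaptedModel n k) 𝓘(ℝ, ℝ) ∞ (pullUp f) := by
  intro u
  obtain ⟨U, hU, hu, F, hF, hFf⟩ := hf (jetProj u)
  have hj := contMDiff_jetProj (P := P) (m := ⊤) u
  refine ((hF.contMDiffAt (hU.mem_nhds hu)).comp u hj).congr_of_eventuallyEq ?_
  filter_upwards [hj.continuousAt (hU.mem_nhds hu)] with v hv
  exact (hFf (jetProj v) hv).symm

/-- The right action `(w · g)_β = g^α_β w_α` of matrices on `Hom(ℝ^(n+k), TE)`. -/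
def frameMul (w : FrameTotal n k E) (g : Matrix (Fin n ⊕ Fin k) (Fin n ⊕ Fin k) ℝ) :
    FrameTotal n k E :=
  ⟨w.1, w.2.comp g.toLin'.toContinuousLinearMap⟩

lemma contMDiffAt_frameMul {w : N → FrameTotal n k E}
    {g : N → Matrix (Fin n ⊕ Fin k) (Fin n ⊕ Fin k) ℝ}
    (hw : ContMDiffAt IN (linearFrameModel n k) m w x₀)
    (hg : ∀ α β, ContMDiffAt IN 𝓘(ℝ, ℝ) m (fun x => g x α β) x₀) :
    ContMDiffAt IN (linearFrameModel n k) m (fun x => frameMul (w x) (g x)) x₀ :=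
  contMDiffAt_hom_comp_of_trivial hw (contMDiffAt_toLin' hg)

lemma frame_adaptedAct (u : P.adaptedFrameBundle)
    {g : Matrix (Fin n ⊕ Fin k) (Fin n ⊕ Fin k) ℝ} (hg : IsUnit g.det)
    (hblock : ∀ i A, g (Sum.inl i) (Sum.inr A) = 0) :
    (adaptedAct u g hg hblock).1.frame = u.1.frame.comp g.toLin'.toContinuousLinearMap := by
  simp only [adaptedAct, adaptedMk]
  rw [frame_adaptedTotalMk]
  ext1 z
  exact DFunLike.congr_fun (linearCombination_sum_smul_single u.1.frame.toLinearMap g) z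

lemma contMDiffAt_adaptedAct {u : N → P.adaptedFrameBundle}
    {g : N → Matrix (Fin n ⊕ Fin k) (Fin n ⊕ Fin k) ℝ} (hdet : ∀ x, IsUnit (g x).det)
    (hblock : ∀ x i A, g x (Sum.inl i) (Sum.inr A) = 0)
    (hu : ContMDiffAt IN (adaptedModel n k) m u x₀)
    (hg : ∀ α β, ContMDiffAt IN 𝓘(ℝ, ℝ) m (fun x => g x α β) x₀) :
    ContMDiffAt IN (adaptedModel n k) m
      (fun x => adaptedAct (u x) (g x) (hdet x) (hblock x)) x₀ := by
  rw [contMDiffAt_opens_iff, ← contMDiffAt_toFrameTotal_iff]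
  refine (contMDiffAt_frameMul ((contMDiff_toFrameTotal _).comp x₀ hu) hg).congr_of_eventuallyEq
    (.of_forall fun x => ?_)
  exact congrArg (TotalSpace.mk (adaptedProj (u x))) (frame_adaptedAct (u x) (hdet x) (hblock x))

lemma contMDiff_vertDeriv {L : P.adaptedFrameBundle → ℝ}
    (hL : ContMDiff (adaptedModel n k) 𝓘(ℝ, ℝ) (m + 1 : ℕ∞) L) (i : Fin n) (A : Fin k) :
    ContMDiff (adaptedModel n k) 𝓘(ℝ, ℝ) m (vertDeriv i A L) := by
  intro u
  have : IsManifold (adaptedModel n k) ∞ P.AdaptedTotal := inferInstance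
  have : IsManifold (adaptedModel n k) ∞ P.adaptedFrameBundle := inferInstance
  have : IsManifold (adaptedModel n k) 1 P.adaptedFrameBundle := .of_le (n := ∞) (by simp)
  refine contMDiffAt_deriv_param (r := (m + 1 : ℕ∞)) ?_ le_rfl
  refine ContMDiffAt.comp (u, (0 : ℝ)) (hL _)
    (contMDiffAt_adaptedAct _ _ contMDiffAt_fst fun α β => ?_)
  simp only [exp_smul_elemMat, Matrix.add_apply, Matrix.smul_apply]
  exact contMDiffAt_const.add (contMDiffAt_snd.smul contMDiffAt_const)

/-- The block triangular matrix `g(u)` with `φ_L(u) = u · g(u)`. -/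
def legendreMatrix (τ : ℕ → ℝ) (L : P.adaptedFrameBundle → ℝ) (u : P.adaptedFrameBundle) :
    Matrix (Fin n ⊕ Fin k) (Fin n ⊕ Fin k) ℝ :=
  .fromBlocks ((1 / (τ n * L u)) • 1)
    (.of fun a A => -((1 / (τ n * L u)) * vertDeriv a A L u)) 0 1

/-- The coefficient matrix of the Cartan-Hamilton-Poincaré form in terms of the soldering form. -/
def chpMatrix (τ : ℕ → ℝ) (L : P.adaptedFrameBundle → ℝ) (u : P.adaptedFrameBundle) :
    Matrix (Fin n ⊕ Fin k) (Fin n ⊕ Fin k) ℝ :=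
  .fromBlocks ((τ n * L u) • 1) (.of fun a A => vertDeriv a A L u) 0 1

lemma legendreMatrix_mul_chpMatrix {τ : ℕ → ℝ} {L : P.adaptedFrameBundle → ℝ}
    {u : P.adaptedFrameBundle} (h : τ n * L u ≠ 0) :
    legendreMatrix τ L u * chpMatrix τ L u = 1 := by
  have hcorner : (1 / (τ n * L u)) • Matrix.of (fun a A => vertDeriv a A L u) +
      Matrix.of (fun a A => -((1 / (τ n * L u)) * vertDeriv a A L u)) = 0 := by
    ext a A
    exact add_neg_cancel _
  simp only [legendreMatrix, chpMatrix, Matrix.fromBlocks_multiply, Matrix.smul_mul,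
    Matrix.one_mul, Matrix.mul_one, Matrix.zero_mul, Matrix.mul_zero, add_zero, zero_add,
    smul_smul, one_div_mul_cancel h, one_smul, hcorner, Matrix.fromBlocks_one]

lemma chpMatrix_mulVec (τ : ℕ → ℝ) (L : P.adaptedFrameBundle → ℝ) (u : P.adaptedFrameBundle)
    (z : Fin n ⊕ Fin k → ℝ) :
    (chpMatrix τ L u).mulVec z = Sum.elim
      (fun i => τ n * L u * z (Sum.inl i) + ∑ A, vertDeriv i A L u * z (Sum.inr A))
      (fun A => z (Sum.inr A)) := by
  simp only [chpMatrix, Matrix.fromBlocks_mulVec, Matrix.smul_mulVec, Matrix.one_mulVec,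
    Matrix.zero_mulVec, zero_add]
  rfl

lemma legendreVec_eq_sum (τ : ℕ → ℝ) (L : P.adaptedFrameBundle → ℝ) (u : P.adaptedFrameBundle) :
    legendreVec τ L u = fun β => ∑ α, legendreMatrix τ L u α β • frameVec u α := by
  funext β
  rw [Fintype.sum_sum_type]
  rcases β with i | A
  · simp [legendreMatrix, legendreVec, Matrix.one_apply]
  · simp [legendreMatrix, legendreVec, Matrix.one_apply, sub_eq_neg_add]

section Legendre

variable {τ : ℕ → ℝ} (hτ : 0 < τ n) {L : P.adaptedFrameBundle → ℝ} (hne : ∀ u, L u ≠ 0)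
  (u : P.adaptedFrameBundle)

lemma frame_legendre :
    (legendre hτ hne u).1.2 =
      u.1.frame.comp (legendreMatrix τ L u).toLin'.toContinuousLinearMap := by
  ext1 z
  simp only [legendre, linearFrameMk, legendreVec_eq_sum]
  exact DFunLike.congr_fun (linearCombination_sum_smul_single u.1.frame.toLinearMap _) z

lemma linearCoframe_legendre :
    linearCoframe (legendre hτ hne u) =
      (chpMatrix τ L u).toLin'.toContinuousLinearMap.comp (coframe u) := by
  have h : τ n * L u ≠ 0 := mul_ne_zero hτ.ne' (hne u)
  have hu : u.1.frame.IsInvertible := u.2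
  have hinv := inverse_toLin'_of_mul_eq_one (legendreMatrix_mul_chpMatrix h)
  exact (congrArg ContinuousLinearMap.inverse (frame_legendre hτ hne u)).trans
    (hu.inverse_comp_of_left.trans (congrArg (fun g => g.comp (coframe u)) hinv))

lemma chpForm_eq_comp_soldering (τ : ℕ → ℝ) (L : P.adaptedFrameBundle → ℝ)
    (u : P.adaptedFrameBundle) :
    chpForm τ L u = (chpMatrix τ L u).toLin'.toContinuousLinearMap.comp (soldering u) := by
  ext1 X
  refine Eq.trans ?_ (chpMatrix_mulVec τ L u (soldering u X)).symm
  ext (i | A) <;> simp [chpForm]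

variable {hτ hne} in
lemma contMDiff_legendre (hL : ContMDiff (adaptedModel n k) 𝓘(ℝ, ℝ) (m + 1 : ℕ∞) L) :
    ContMDiff (adaptedModel n k) (linearFrameModel n k) m (legendre hτ hne) := by
  intro u
  have hs : ContMDiff (adaptedModel n k) 𝓘(ℝ, ℝ) m (fun u => 1 / (τ n * L u)) :=
    contMDiff_const.div₀ (contMDiff_const.mul (hL.of_le (by exact_mod_cast le_self_add)))
      fun u => mul_ne_zero hτ.ne' (hne u)
  rw [contMDiffAt_opens_iff]
  refine (contMDiffAt_frameMul (g := legendreMatrix τ L) (contMDiff_toFrameTotal u)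
    ?_).congr_of_eventuallyEq (.of_forall fun u => ?_)
  · rintro (i | A) (j | B)
    · exact (hs u).smul contMDiffAt_const
    · exact ((hs u).mul (contMDiff_vertDeriv hL i B u)).neg
    · exact contMDiffAt_const
    · exact contMDiffAt_const
  · exact congrArg (TotalSpace.mk (adaptedProj u)) (frame_legendre hτ hne u)

end Legendre

lemma contMDiff_linearFrameProj :
    ContMDiff (linearFrameModel n k) (𝓡 (n + k)) m (linearFrameProj (n := n) (k := k) (E := E)) :=
  (contMDiff_proj _).comp contMDiff_subtype_val

lemma linearSoldering_comp_mfderiv {Φ : N → linearFrameBundle n k E}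
    (hΦ : MDifferentiableAt IN (linearFrameModel n k) Φ x₀) :
    (linearSoldering (Φ x₀)).comp (mfderiv IN (linearFrameModel n k) Φ x₀) =
      (linearCoframe (Φ x₀)).comp (mfderiv IN (𝓡 (n + k)) (fun x => linearFrameProj (Φ x)) x₀) := by
  have hproj : MDifferentiableAt (linearFrameModel n k) (𝓡 (n + k))
      (linearFrameProj (n := n) (k := k) (E := E)) (Φ x₀) :=
    (contMDiff_linearFrameProj (m := ⊤) _).mdifferentiableAt (by simp)
  exact congrArg (linearCoframe (Φ x₀)).comp (mfderiv_comp x₀ hproj hΦ).symm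

lemma linearSoldering_comp_mfderiv_legendre {τ : ℕ → ℝ} {hτ : 0 < τ n}
    {L : P.adaptedFrameBundle → ℝ} {hne : ∀ u, L u ≠ 0} {u : P.adaptedFrameBundle}
    (h : MDifferentiableAt (adaptedModel n k) (linearFrameModel n k) (legendre hτ hne) u) :
    (linearSoldering (legendre hτ hne u)).comp
        (mfderiv (adaptedModel n k) (linearFrameModel n k) (legendre hτ hne) u) =
      chpForm τ L u := by
  rw [linearSoldering_comp_mfderiv h, linearCoframe_legendre, chpForm_eq_comp_soldering]
  rfl

end FiberedManifold

end

theorem mainTheorem4_general {n k : ℕ} {E M : Type*}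
    [TopologicalSpace M] [ChartedSpace (EuclideanSpace ℝ (Fin n)) M] [IsManifold (𝓡 n) ∞ M]
    [TopologicalSpace E] [ChartedSpace (EuclideanSpace ℝ (Fin (n + k))) E]
    [IsManifold (𝓡 (n + k)) ∞ E]
    (P : FiberedManifold n k E M) (τ : ℕ → ℝ) (hτ : 0 < τ n) {m : ℕ∞} (hm : 1 ≤ m)
    (L : P.adaptedFrameBundle → ℝ)
    (hL : ContMDiff (FiberedManifold.adaptedModel n k) 𝓘(ℝ, ℝ) (m + 1 : ℕ∞) L)
    (hne : ∀ u, L u ≠ 0) :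
    ContMDiff (FiberedManifold.adaptedModel n k) (FiberedManifold.linearFrameModel n k) m
        (FiberedManifold.legendre hτ hne) ∧
      ∀ u : P.adaptedFrameBundle,
        (FiberedManifold.linearSoldering (FiberedManifold.legendre hτ hne u)).comp
            (mfderiv (FiberedManifold.adaptedModel n k) (FiberedManifold.linearFrameModel n k)
              (FiberedManifold.legendre hτ hne) u) =
          FiberedManifold.chpForm τ L u := by
  have hleg := FiberedManifold.contMDiff_legendre (hτ := hτ) (hne := hne) hL
  refine ⟨hleg, fun u => FiberedManifold.linearSoldering_comp_mfderiv_legendre ?_⟩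
  exact (hleg u).mdifferentiableAt (by exact_mod_cast (zero_lt_one.trans_le hm).ne')

theorem mainTheorem4 {n k : ℕ} {E M : Type*}
    [TopologicalSpace M] [ChartedSpace (EuclideanSpace ℝ (Fin n)) M] [IsManifold (𝓡 n) ∞ M]
    [TopologicalSpace E] [ChartedSpace (EuclideanSpace ℝ (Fin (n + k))) E]
    [IsManifold (𝓡 (n + k)) ∞ E]
    (P : FiberedManifold n k E M)
    (τ : ℕ → ℝ) (hτ : ∀ j, 0 < τ j)
    (ℒ : P.jetBundle → ℝ) (hsmooth : FiberedManifold.IsSmoothOnJets ℒ)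
    (L : P.adaptedFrameBundle → ℝ) (hpull : L = FiberedManifold.pullUp ℒ)
    (hne : ∀ u, L u ≠ 0) :
    ContMDiff (FiberedManifold.adaptedModel n k) (FiberedManifold.linearFrameModel n k) ∞
        (FiberedManifold.legendre (hτ n) hne) ∧
      ∀ u : P.adaptedFrameBundle,
        (FiberedManifold.linearSoldering (FiberedManifold.legendre (hτ n) hne u)).comp
            (mfderiv (FiberedManifold.adaptedModel n k) (FiberedManifold.linearFrameModel n k)
              (FiberedManifold.legendre (hτ n) hne) u) =
          FiberedManifold.chpForm τ L u := by
  subst hpull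
  exact mainTheorem4_general P τ (hτ n) (m := ⊤) le_top _
    (FiberedManifold.contMDiff_pullUp hsmooth) hne
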